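/- Let $K$ be an algebraically closed field of characteristic zero. For $k\ge 0$ let $K[[x_1,\dots,x_k]]$ act on $K[y_1,\dots,y_k]$ by $f\circ g=f(\partial_{y_1},\dots,\partial_{y_k})(g)$, and for $F\in K[y_1,\dots,y_k]$ put $\mathrm{Ann}(F)=\{f\in K[[x_1,\dots,x_k]] : f\circ F=0\}$ and $A_F=K[[x_1,\dots,x_k]]/\mathrm{Ann}(F)$. For a local $K$-algebra $(A,\mathfrak m)$ that is a quotient of a power series ring over $K$, the Hilbert function is $HF_A(i)=\dim_K(\mathfrak m^i/\mathfrak m^{i+1})$, $i\ge 0$; if $A$ is Artinian, it is called Gorenstein when $\dim_K(0:\mathfrak m)=1$. A polynomial $F\in K[y_1,\dots,y_k]$ is called non-degenerate if $A_F$ is a local ring (equivalently, $F\neq 0$) and $HF_{A_F}(1)=k$. **Theorem.** Let $m>n\ge 0$ be integers and let $A$ be a $K$-algebra that is a quotient of a power series ring $K[[x_1,\dots,x_r]]$ for some $r\ge 0$. The following are equivalent: (a) $A$ is an Artinian Gorenstein local ring with Hilbert function $\{1,m,n,1\}$, i.e. $HF_A(0)=1$, $HF_A(1)=m$, $HF_A(2)=n$,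 $HF_A(3)=1$ and $HF_A(i)=0$ for $i\ge 4$. (b) There is a non-degenerate form $F_3\in K[y_1,\dots,y_n]$ of degree three such that $A\simeq A_F$ as $K$-algebras, where $F=F_3+y_{n+1}^2+\dots+y_m^2\in K[y_1,\dots,y_m]$. -/

import Mathlib

noncomputable section

namespace InverseSystem

variable {K : Type*} [Field K] {m : ℕ}

/-- Partial derivatives of polynomials commute. -/
theorem pderiv_commute (i j : Fin m) :
    Commute ((MvPolynomial.pderiv i).toLinearMap : Module.End K (MvPolynomial (Fin m) K))
      ((MvPolynomial.pderiv j).toLinearMap : Module.End K (MvPolynomial (Fin m) K)) := by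
  have h : ⁅(MvPolynomial.pderiv i : Derivation K (MvPolynomial (Fin m) K) _),
      (MvPolynomial.pderiv j : Derivation K (MvPolynomial (Fin m) K) _)⁆ = 0 := by
    apply MvPolynomial.derivation_ext
    intro k
    rw [Derivation.commutator_apply]
    simp [MvPolynomial.pderiv_X, Pi.single_apply, apply_ite]
  apply LinearMap.ext
  intro p
  have hp := congrArg (fun D : Derivation K (MvPolynomial (Fin m) K) _ => D p) h
  simp only [Derivation.commutator_apply, Derivation.coe_zero, Pi.zero_apply] at hp
  exact sub_eq_zero.mp hp

theorem pairwise_commute_pderiv_pow (α : Fin m →₀ ℕ) :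
    ((Finset.univ : Finset (Fin m)) : Set (Fin m)).Pairwise (Function.onFun Commute fun i =>
      ((MvPolynomial.pderiv i).toLinearMap : Module.End K (MvPolynomial (Fin m) K)) ^ α i) :=
  fun i _ j _ _ => (pderiv_commute i j).pow_pow _ _

/-- The iterated partial derivative `∂^α = ∂_{y_1}^{α_1} ⋯ ∂_{y_m}^{α_m}` on `K[y_1, …, y_m]`. -/
def iterPartial (α : Fin m →₀ ℕ) : Module.End K (MvPolynomial (Fin m) K) :=
  Finset.univ.noncommProd
    (fun i => ((MvPolynomial.pderiv i).toLinearMap : Module.End K (MvPolynomial (Fin m) K)) ^ α i)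
    (pairwise_commute_pderiv_pow α)

theorem iterPartial_add (α β : Fin m →₀ ℕ) :
    (iterPartial (α + β) : Module.End K (MvPolynomial (Fin m) K))
      = iterPartial α * iterPartial β := by
  unfold iterPartial
  rw [← Finset.noncommProd_mul_distrib]
  · apply Finset.noncommProd_congr rfl
    intro i _
    simp [pow_add]
  · exact fun i _ j _ _ => (pderiv_commute i j).pow_pow _ _

theorem iterPartial_single (i : Fin m) (k : ℕ) :
    (iterPartial (Finsupp.single i k) : Module.End K (MvPolynomial (Fin m) K))
      = (MvPolynomial.pderiv i).toLinearMap ^ k := by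
  unfold iterPartial
  rw [← Finset.mul_noncommProd_erase Finset.univ (Finset.mem_univ i)]
  have h := Finset.noncommProd_eq_pow_card (Finset.univ.erase i)
    (fun j => ((MvPolynomial.pderiv j).toLinearMap : Module.End K (MvPolynomial (Fin m) K))
      ^ (Finsupp.single i k) j)
    ((pairwise_commute_pderiv_pow _).mono fun _ _ => by simp) 1 (by
      intro j hj
      rw [Finsupp.single_eq_of_ne (Finset.ne_of_mem_erase hj), pow_zero])
  rw [one_pow] at h
  refine (congrArg _ h).trans ?_
  rw [mul_one, Finsupp.single_eq_same]

theorem pderiv_pow_monomial (i : Fin m) (k : ℕ) (β : Fin m →₀ ℕ) (c : K) :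
    (((MvPolynomial.pderiv i).toLinearMap : Module.End K (MvPolynomial (Fin m) K)) ^ k)
        (MvPolynomial.monomial β c)
      = MvPolynomial.monomial (β - Finsupp.single i k) (c * ((β i).descFactorial k : K)) := by
  induction k with
  | zero => simp
  | succ k ih =>
    rw [pow_succ', Module.End.mul_apply, ih]
    simp only [Derivation.coeFn_coe, MvPolynomial.pderiv_monomial, Finsupp.coe_tsub, Pi.sub_apply,
      Finsupp.single_eq_same, Nat.descFactorial_succ, Nat.cast_mul]
    rw [tsub_tsub, ← Finsupp.single_add]
    congr 1
    ring

/-- `∂^α y^β = (β! / (β - α)!) y^{β - α}`, which is zero unless `α ≤ β`. -/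
theorem iterPartial_monomial (α β : Fin m →₀ ℕ) (c : K) :
    iterPartial α (MvPolynomial.monomial β c)
      = MvPolynomial.monomial (β - α) (c * ∏ i, ((β i).descFactorial (α i) : K)) := by
  induction α using Finsupp.induction generalizing β c with
  | zero =>
    have h0 : (iterPartial 0 : Module.End K (MvPolynomial (Fin m) K)) = 1 := by
      unfold iterPartial
      rw [Finset.noncommProd_eq_pow_card _ _ _ 1 (fun i _ => by simp), one_pow]
    simp [h0]
  | single_add i k f hi _ ih =>
    have hfi : f i = 0 := Finsupp.notMem_support_iff.mp hi
    rw [iterPartial_add, Module.End.mul_apply, ih, iterPartial_single, pderiv_pow_monomial,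
      tsub_tsub, add_comm f]
    congr 1
    rw [mul_assoc]
    congr 1
    rw [← Finset.mul_prod_erase _ _ (Finset.mem_univ i),
      ← Finset.mul_prod_erase Finset.univ
        (fun j => ((β j).descFactorial ((Finsupp.single i k + f) j) : K)) (Finset.mem_univ i)]
    have hprod : ∀ j ∈ Finset.univ.erase i,
        ((β j).descFactorial ((Finsupp.single i k + f) j) : K)
          = ((β j).descFactorial (f j) : K) := by
      intro j hj
      rw [Finsupp.add_apply, Finsupp.single_eq_of_ne (Finset.ne_of_mem_erase hj), zero_add]
    rw [Finset.prod_congr rfl hprod]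
    simp [hfi, mul_comm]

theorem finite_iterPartial_ne_zero (g : MvPolynomial (Fin m) K) :
    {α : Fin m →₀ ℕ | iterPartial α g ≠ 0}.Finite := by
  refine (Set.Finite.biUnion g.support.finite_toSet
    (t := fun β => Set.Iic β) (fun β _ => Set.finite_Iic β)).subset ?_
  intro α hα
  by_contra hne
  apply hα
  rw [g.as_sum, map_sum]
  refine Finset.sum_eq_zero (fun β hβ => ?_)
  have hle : ¬ α ≤ β := fun h => hne (Set.mem_biUnion (Finset.mem_coe.mpr hβ) h)
  obtain ⟨i, hi⟩ : ∃ i, β i < α i := by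
    by_contra! hcon
    exact hle hcon
  rw [iterPartial_monomial, Finset.prod_eq_zero (Finset.mem_univ i), mul_zero,
    MvPolynomial.monomial_zero]
  rw [Nat.descFactorial_of_lt hi, Nat.cast_zero]

/-- The action `f ∘ g = f(∂_{y_1}, …, ∂_{y_m})(g)` of `R = K[[x_1, …, x_m]]` on
`P = K[y_1, …, y_m]`. For each `g` only finitely many terms of the sum are nonzero
(`finite_iterPartial_ne_zero`). -/
def act (f : MvPowerSeries (Fin m) K) (g : MvPolynomial (Fin m) K) : MvPolynomial (Fin m) K :=
  ∑ᶠ α : Fin m →₀ ℕ, MvPowerSeries.coeff α f • iterPartial α g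

theorem finite_support_act (f : MvPowerSeries (Fin m) K) (g : MvPolynomial (Fin m) K) :
    (Function.support fun α : Fin m →₀ ℕ =>
      MvPowerSeries.coeff α f • iterPartial α g).Finite :=
  (finite_iterPartial_ne_zero g).subset fun α hα h => hα (by simp [h])

theorem act_zero_right (f : MvPowerSeries (Fin m) K) : act f 0 = 0 := by
  simp [act]

theorem act_add_left (f f' : MvPowerSeries (Fin m) K) (g : MvPolynomial (Fin m) K) :
    act (f + f') g = act f g + act f' g := by
  unfold act
  rw [← finsum_add_distrib (finite_support_act f g) (finite_support_act f' g)]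
  simp [add_smul]

theorem act_mul (f h : MvPowerSeries (Fin m) K) (g : MvPolynomial (Fin m) K) :
    act (f * h) g = act f (act h g) := by
  classical
  set T : (Fin m →₀ ℕ) × (Fin m →₀ ℕ) → MvPolynomial (Fin m) K := fun p =>
    (MvPowerSeries.coeff p.1 f * MvPowerSeries.coeff p.2 h) • iterPartial (p.1 + p.2) g with hT
  set D := (finite_iterPartial_ne_zero g).toFinset with hD
  have hsub : Function.support T ⊆
      ((D.biUnion fun δ => Finset.HasAntidiagonal.antidiagonal δ : Finset _) : Set _) := by
    intro p hp
    rw [Finset.mem_coe, Finset.mem_biUnion]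
    refine ⟨p.1 + p.2, ?_, by simp⟩
    rw [hD, Set.Finite.mem_toFinset]
    intro h0
    exact hp (by simp only [hT, h0, smul_zero])
  have hfin : (Function.support T).Finite := (Finset.finite_toSet _).subset hsub
  have hright : act f (act h g) = ∑ᶠ p, T p := by
    rw [finsum_curry _ hfin]
    unfold act
    refine finsum_congr fun α => ?_
    rw [show iterPartial α (∑ᶠ β : Fin m →₀ ℕ, MvPowerSeries.coeff β h • iterPartial β g)
        = ∑ᶠ β : Fin m →₀ ℕ, iterPartial α (MvPowerSeries.coeff β h • iterPartial β g) from
        (iterPartial α : Module.End K (MvPolynomial (Fin m) K)).toAddMonoidHom.map_finsum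
          (finite_support_act h g), smul_finsum]
    refine finsum_congr fun β => ?_
    simp only [hT, map_smul, smul_smul, iterPartial_add, Module.End.mul_apply]
  have hleft : act (f * h) g = ∑ᶠ p, T p := by
    rw [finsum_eq_sum_of_support_subset T hsub, Finset.sum_biUnion]
    · unfold act
      rw [finsum_eq_sum_of_support_subset (s := D)]
      · refine Finset.sum_congr rfl fun δ _ => ?_
        rw [MvPowerSeries.coeff_mul, Finset.sum_smul]
        refine Finset.sum_congr rfl fun p hp => ?_
        rw [Finset.HasAntidiagonal.mem_antidiagonal] at hp
        simp only [hT, hp]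
      · intro δ hδ
        rw [Finset.mem_coe, hD, Set.Finite.mem_toFinset]
        intro h0
        exact hδ (by simp only [h0, smul_zero])
    · intro δ _ ε _ hne
      rw [Function.onFun, Finset.disjoint_left]
      intro p hp hp'
      rw [Finset.HasAntidiagonal.mem_antidiagonal] at hp hp'
      exact hne (hp.symm.trans hp')
  rw [hleft, hright]

/-- `Ann_R(F) = {f ∈ R | f ∘ F = 0}`, an ideal of `R = K[[x_1, …, x_m]]`. -/
def ann (F : MvPolynomial (Fin m) K) : Ideal (MvPowerSeries (Fin m) K) where
  carrier := {f | act f F = 0}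
  zero_mem' := by simp [act]
  add_mem' {f f'} hf hf' := by
    simp only [Set.mem_ofPred_eq] at hf hf' ⊢
    rw [act_add_left, hf, hf', add_zero]
  smul_mem' f h hh := by
    simp only [Set.mem_ofPred_eq, smul_eq_mul] at hh ⊢
    rw [act_mul, hh, act_zero_right]

/-- The `K`-algebra `A_F = R / Ann_R(F)`. -/
abbrev algebraOf (F : MvPolynomial (Fin m) K) : Type _ := MvPowerSeries (Fin m) K ⧸ ann F

section LocalAlgebra

variable (K) (A : Type*) [CommRing A] [Algebra K A] [IsLocalRing A]

/-- The Hilbert function `i ↦ dim_K (𝔪^i / 𝔪^(i+1))` of a local `K`-algebra `(A, 𝔪)`. -/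
def hilbertFunction (i : ℕ) : ℕ :=
  Module.finrank K
    (↥(IsLocalRing.maximalIdeal A ^ i) ⧸
      Submodule.submoduleOf (IsLocalRing.maximalIdeal A ^ (i + 1))
        (IsLocalRing.maximalIdeal A ^ i))

/-- An Artinian local `K`-algebra (with residue field `K`) is Gorenstein when its socle `0 : 𝔪`
has dimension one over `K`. -/
def IsArtinianGorenstein : Prop :=
  IsArtinianRing A ∧
    Module.finrank K
      ↥((⊥ : Ideal A).colon (IsLocalRing.maximalIdeal A : Set A)) = 1

end LocalAlgebra

/-- `F ∈ K[y_1, …, y_m]` is non-degenerate if `A_F` is a local ring of embedding dimension `m`,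
that is `HF_{A_F}(1) = m`. (For `F = 0` the ring `A_F` is zero, so `F` is degenerate; for `F ≠ 0`
it is always local.) -/
def IsNondegenerate (F : MvPolynomial (Fin m) K) : Prop :=
  ∃ _ : IsLocalRing (algebraOf F), hilbertFunction K (algebraOf F) 1 = m

end InverseSystem

end

noncomputable section

namespace InverseSystem

/-! ### Partial derivatives and the filtration they induce -/

section Action

variable {K : Type*} [Field K] {m : ℕ}

/-! The map f ↦ f ∘ F embeds A_F into the polynomial ring and carries 𝔪^i onto the span of the
partials of F of order at least i (`map_actLin_pow`). Hence HF(i) is the drop in dimension from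
`derivSpan i F` to `derivSpan (i + 1) F`, and the socle corresponds to the constants
(`finrank_socle`). In particular, a nonzero cubic form is non-degenerate exactly when its first
partials are linearly independent. For a non-degenerate cubic plus d = m - n squares these spans can
be written down, which gives (b) ⇒ (a).

For (a) ⇒ (b), choose a functional φ₀ on A that is nonzero on the socle. Then B(x, y) = φ₀(xy) is a
nondegenerate symmetric form, N = 𝔪² is isotropic because 𝔪⁴ = 0, and N^⊥ is the annihilator of 𝔪².
Linear algebra (`exists_adapted_system`) gives v_j in N^⊥, orthogonal with B(v_j, v_j) = 2, and u_i
completing N^⊥ to 𝔪, orthogonal to the v_j and to each other. Keeping φ₀ on 𝔪² but making it vanish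
on 1, u, v gives a functional φ (`exists_isNormalForm`) that is still nonzero on the socle. Its
moments φ(u^α v^β) are the values at 0 of the partials of a cubic in n variables plus d squares.

Such moments determine the algebra (`nonempty_algEquiv_algebraOf`): p vanishes at the generators iff
φ kills all multiples of its value, iff p ∘ F = 0. A relation among the partials of the cubic would
give a combination of the u_i annihilating 𝔪², hence lying in N^⊥, so the partials are independent
(`linearIndependent_pderiv`). -/

theorem coeff_iterPartial (α β : Fin m →₀ ℕ) (F : MvPolynomial (Fin m) K) :
    MvPolynomial.coeff β (iterPartial α F)
      = MvPolynomial.coeff (β + α) F * ∏ i, ((β i + α i).descFactorial (α i) : K) := by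
  classical
  induction F using MvPolynomial.induction_on' with
  | add p q hp hq => simp only [map_add, MvPolynomial.coeff_add, hp, hq, add_mul]
  | monomial γ c =>
    rw [iterPartial_monomial, MvPolynomial.coeff_monomial, MvPolynomial.coeff_monomial]
    by_cases h : γ = β + α
    · subst h
      simp
    · rw [if_neg h, zero_mul]
      split_ifs with h'
      · have hle : ¬ α ≤ γ := fun hle => h (by rw [← h', tsub_add_cancel_of_le hle])
        obtain ⟨i, hi⟩ : ∃ i, γ i < α i := by
          by_contra! hcon
          exact hle hcon
        rw [Finset.prod_eq_zero (Finset.mem_univ i), mul_zero]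
        rw [Nat.descFactorial_of_lt hi, Nat.cast_zero]
      · rfl

theorem prod_descFactorial_ne_zero [CharZero K] (α β : Fin m →₀ ℕ) :
    ∏ i, ((β i + α i).descFactorial (α i) : K) ≠ 0 := by
  refine Finset.prod_ne_zero_iff.mpr fun i _ => ?_
  rw [Nat.cast_ne_zero, Ne, Nat.descFactorial_eq_zero_iff_lt]
  omega

theorem coeff_zero_iterPartial (α : Fin m →₀ ℕ) (F : MvPolynomial (Fin m) K) :
    MvPolynomial.coeff 0 (iterPartial α F)
      = MvPolynomial.coeff α F * ∏ i, ((α i).factorial : K) := by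
  simp [coeff_iterPartial, Nat.descFactorial_self]

theorem iterPartial_zero (F : MvPolynomial (Fin m) K) : iterPartial 0 F = F := by
  ext β
  simp [coeff_iterPartial]

theorem iterPartial_single_one (i : Fin m) (F : MvPolynomial (Fin m) K) :
    iterPartial (Finsupp.single i 1) F = MvPolynomial.pderiv i F := by
  rw [iterPartial_single, pow_one]
  rfl

theorem iterPartial_comm (α β : Fin m →₀ ℕ) (F : MvPolynomial (Fin m) K) :
    iterPartial α (iterPartial β F) = iterPartial β (iterPartial α F) := by
  rw [← Module.End.mul_apply, ← iterPartial_add, add_comm, iterPartial_add, Module.End.mul_apply]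

/-- The action on a fixed polynomial, as a linear map. -/
def actLin (F : MvPolynomial (Fin m) K) : MvPowerSeries (Fin m) K →ₗ[K] MvPolynomial (Fin m) K where
  toFun f := act f F
  map_add' f g := act_add_left f g F
  map_smul' c f := by
    simp only [act, RingHom.id_apply]
    rw [smul_finsum]
    simp [mul_smul]

theorem actLin_apply (F : MvPolynomial (Fin m) K) (f : MvPowerSeries (Fin m) K) :
    actLin F f = act f F := rfl

theorem act_monomial (α : Fin m →₀ ℕ) (c : K) (F : MvPolynomial (Fin m) K) :
    act (MvPowerSeries.monomial α c) F = c • iterPartial α F := by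
  classical
  unfold act
  rw [finsum_eq_single _ α]
  · simp
  · intro β hβ
    rw [MvPowerSeries.coeff_monomial, if_neg hβ, zero_smul]

theorem mem_ann_iff (F : MvPolynomial (Fin m) K) (f : MvPowerSeries (Fin m) K) :
    f ∈ ann F ↔ act f F = 0 := Iff.rfl

/-- The span of the partial derivatives of `F` of order at least `i`. -/
def derivSpan (i : ℕ) (F : MvPolynomial (Fin m) K) : Submodule K (MvPolynomial (Fin m) K) :=
  Submodule.span K {G | ∃ α : Fin m →₀ ℕ, i ≤ α.degree ∧ iterPartial α F = G}

theorem iterPartial_mem_derivSpan {i : ℕ} {α : Fin m →₀ ℕ} (h : i ≤ α.degree)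
    (F : MvPolynomial (Fin m) K) : iterPartial α F ∈ derivSpan i F :=
  Submodule.subset_span ⟨α, h, rfl⟩

theorem mem_maximalIdeal_iff (f : MvPowerSeries (Fin m) K) :
    f ∈ IsLocalRing.maximalIdeal (MvPowerSeries (Fin m) K) ↔
      MvPowerSeries.constantCoeff f = 0 := by
  rw [IsLocalRing.mem_maximalIdeal, mem_nonunits_iff, MvPowerSeries.isUnit_iff_constantCoeff,
    isUnit_iff_ne_zero, not_not]

theorem le_order_of_mem_pow {i : ℕ} {f : MvPowerSeries (Fin m) K}
    (hf : f ∈ IsLocalRing.maximalIdeal (MvPowerSeries (Fin m) K) ^ i) :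
    (i : ℕ∞) ≤ f.order := by
  induction i generalizing f with
  | zero => simp
  | succ i ih =>
    rw [pow_succ] at hf
    refine Submodule.mul_induction_on hf (fun a ha b hb => ?_) (fun a b ha hb => ?_)
    · refine le_trans ?_ MvPowerSeries.le_order_mul
      push_cast
      refine add_le_add (ih ha) ?_
      rw [Order.one_le_iff_pos, pos_iff_ne_zero, MvPowerSeries.order_ne_zero_iff_constCoeff_eq_zero]
      exact (mem_maximalIdeal_iff b).mp hb
    · exact le_trans (le_min ha hb) MvPowerSeries.min_order_le_add

theorem monomial_mem_pow {i : ℕ} {α : Fin m →₀ ℕ} (h : i ≤ α.degree) (c : K) :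
    MvPowerSeries.monomial α c ∈ IsLocalRing.maximalIdeal (MvPowerSeries (Fin m) K) ^ i := by
  induction i generalizing α c with
  | zero => simp
  | succ i ih =>
    obtain ⟨j, hj⟩ : ∃ j, α j ≠ 0 := by
      by_contra! hcon
      have : α = 0 := by ext j; exact hcon j
      simp [this] at h
    have hα : α = (α - Finsupp.single j 1) + Finsupp.single j 1 := by
      rw [tsub_add_cancel_of_le]
      rw [Finsupp.single_le_iff]
      omega
    have hd : α.degree = (α - Finsupp.single j 1).degree + 1 := by
      conv_lhs => rw [hα]
      simp
    have hm : MvPowerSeries.monomial α c = MvPowerSeries.monomial (α - Finsupp.single j 1) c *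
        MvPowerSeries.monomial (Finsupp.single j 1) (1 : K) := by
      rw [MvPowerSeries.monomial_mul_monomial, ← hα, mul_one]
    rw [hm, pow_succ]
    refine Ideal.mul_mem_mul (ih (by omega) c) ?_
    rw [mem_maximalIdeal_iff]
    exact MvPowerSeries.constantCoeff_X j

theorem act_mem_derivSpan {i : ℕ} {f : MvPowerSeries (Fin m) K}
    (hf : f ∈ IsLocalRing.maximalIdeal (MvPowerSeries (Fin m) K) ^ i)
    (F : MvPolynomial (Fin m) K) : act f F ∈ derivSpan i F := by
  unfold act
  refine finsum_induction (· ∈ derivSpan i F) (Submodule.zero_mem _)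
    (fun _ _ => Submodule.add_mem _) fun α => ?_
  by_cases h : i ≤ α.degree
  · exact Submodule.smul_mem _ _ (iterPartial_mem_derivSpan h F)
  · rw [MvPowerSeries.coeff_of_lt_order, zero_smul]
    · exact Submodule.zero_mem _
    · refine lt_of_lt_of_le ?_ (le_order_of_mem_pow hf)
      exact_mod_cast not_le.mp h

/-- A series in 𝔪^i has no terms of degree below i, and conversely the monomials of degree at least
i lie in 𝔪^i. This turns the Hilbert function of A_F into a count of derivatives. -/
theorem map_actLin_pow (i : ℕ) (F : MvPolynomial (Fin m) K) :
    ((IsLocalRing.maximalIdeal (MvPowerSeries (Fin m) K) ^ i).restrictScalars K).map (actLin F)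
      = derivSpan i F := by
  apply le_antisymm
  · rintro _ ⟨f, hf, rfl⟩
    exact act_mem_derivSpan hf F
  · refine Submodule.span_le.mpr ?_
    rintro _ ⟨α, hα, rfl⟩
    exact ⟨MvPowerSeries.monomial α 1, monomial_mem_pow hα 1, by
      rw [actLin_apply, act_monomial, one_smul]⟩

instance finite_derivSpan (i : ℕ) (F : MvPolynomial (Fin m) K) :
    Module.Finite K (derivSpan i F) := by
  have hfin : (iterPartial · F) '' {α | iterPartial α F ≠ 0} |>.Finite :=
    (finite_iterPartial_ne_zero F).image _
  have := Module.Finite.span_of_finite K hfin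
  refine Submodule.finiteDimensional_of_le (S₂ := Submodule.span K
    ((iterPartial · F) '' {α | iterPartial α F ≠ 0})) ?_
  refine Submodule.span_le.mpr ?_
  rintro _ ⟨α, -, rfl⟩
  by_cases h : iterPartial α F = 0
  · rw [h]; exact Submodule.zero_mem _
  · exact Submodule.subset_span ⟨α, h, rfl⟩

theorem derivSpan_antitone (F : MvPolynomial (Fin m) K) : Antitone (derivSpan · F) := by
  intro i j hij
  refine Submodule.span_mono ?_
  rintro _ ⟨α, hα, rfl⟩
  exact ⟨α, hij.trans hα, rfl⟩

end Action

/-! ### Hilbert function of A_F in terms of derivatives -/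

section Transport

variable {K : Type*} [Field K] {m : ℕ} {A : Type*} [CommRing A] [Algebra K A]

/-- The `m`-adic filtration by `K`-subspaces. -/
abbrev maxPow (K A : Type*) [Field K] [CommRing A] [Algebra K A] [IsLocalRing A] (i : ℕ) :
    Submodule K A :=
  (IsLocalRing.maximalIdeal A ^ i).restrictScalars K

theorem hilbertFunction_add [IsLocalRing A] [Module.Finite K A] (i : ℕ) :
    hilbertFunction K A i + Module.finrank K (maxPow K A (i + 1))
      = Module.finrank K (maxPow K A i) := by
  have h := Submodule.finrank_quotient_add_finrank (R := K)
    ((Submodule.submoduleOf (IsLocalRing.maximalIdeal A ^ (i + 1))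
        (IsLocalRing.maximalIdeal A ^ i)).restrictScalars K : Submodule K (maxPow K A i))
  refine (congrArg (hilbertFunction K A i + ·) (LinearEquiv.finrank_eq ?_).symm).trans h
  exact Submodule.submoduleOfEquivOfLe (p := maxPow K A (i+1)) (q := maxPow K A i)
    (Ideal.pow_le_pow_right (Nat.le_succ i))

/-- Packages A ≃ A_F as a surjection from power series and an embedding into polynomials, so later
arguments avoid the quotient. -/
theorem exists_presentation {F : MvPolynomial (Fin m) K} (e : A ≃ₐ[K] algebraOf F) :
    ∃ (π : MvPowerSeries (Fin m) K →ₐ[K] A) (Φ : A →ₗ[K] MvPolynomial (Fin m) K),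
      Function.Surjective π ∧ Function.Injective Φ ∧ ∀ f, Φ (π f) = act f F := by
  let q : algebraOf F →ₗ[K] MvPolynomial (Fin m) K :=
    Submodule.liftQ ((ann F).restrictScalars K) (actLin F) (fun f hf => hf)
  refine ⟨e.symm.toAlgHom.comp (Ideal.Quotient.mkₐ K (ann F)), q.comp e.toLinearMap,
    e.symm.surjective.comp Ideal.Quotient.mk_surjective, ?_, fun f => ?_⟩
  · have hq : Function.Injective q := by
      rw [injective_iff_map_eq_zero]
      intro x hx
      obtain ⟨f, rfl⟩ := Ideal.Quotient.mk_surjective x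
      exact Ideal.Quotient.eq_zero_iff_mem.mpr hx
    exact fun x y h => e.injective (hq h)
  · change q (e (e.symm _)) = _
    rw [AlgEquiv.apply_symm_apply]
    rfl

variable {F : MvPolynomial (Fin m) K} {π : MvPowerSeries (Fin m) K →ₐ[K] A}
  {Φ : A →ₗ[K] MvPolynomial (Fin m) K}

theorem maximalIdeal_pow_eq_map [IsLocalRing A] (hπ : Function.Surjective π) (i : ℕ) :
    IsLocalRing.maximalIdeal A ^ i =
      (IsLocalRing.maximalIdeal (MvPowerSeries (Fin m) K) ^ i).map π := by
  rw [Ideal.map_pow]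
  congr 1
  have hc : ((IsLocalRing.maximalIdeal A).comap π).IsMaximal :=
    Ideal.comap_isMaximal_of_surjective π hπ
  rw [← IsLocalRing.eq_maximalIdeal hc]
  exact (Ideal.map_comap_of_surjective _ hπ _).symm

theorem map_maxPow [IsLocalRing A] (hπ : Function.Surjective π)
    (hΦπ : ∀ f, Φ (π f) = act f F) (i : ℕ) :
    (maxPow K A i).map Φ = derivSpan i F := by
  rw [← map_actLin_pow]
  ext G
  constructor
  · rintro ⟨x, hx, rfl⟩
    have hx' : x ∈ IsLocalRing.maximalIdeal A ^ i := hx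
    rw [maximalIdeal_pow_eq_map hπ, Ideal.mem_map_iff_of_surjective _ hπ] at hx'
    obtain ⟨f, hf, rfl⟩ := hx'
    exact ⟨f, hf, (hΦπ f).symm⟩
  · rintro ⟨f, hf, rfl⟩
    refine ⟨π f, ?_, hΦπ f⟩
    change π f ∈ IsLocalRing.maximalIdeal A ^ i
    rw [maximalIdeal_pow_eq_map hπ]
    exact Ideal.mem_map_of_mem π hf

theorem finrank_maxPow [IsLocalRing A] (hπ : Function.Surjective π) (hΦ : Function.Injective Φ)
    (hΦπ : ∀ f, Φ (π f) = act f F) (i : ℕ) :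
    Module.finrank K (maxPow K A i) = Module.finrank K (derivSpan i F) := by
  rw [← map_maxPow hπ hΦπ]
  exact (Submodule.equivMapOfInjective Φ hΦ _).finrank_eq

theorem finite_of_presentation (hπ : Function.Surjective π) (hΦ : Function.Injective Φ)
    (hΦπ : ∀ f, Φ (π f) = act f F) : Module.Finite K A := by
  refine Module.Finite.of_injective (Φ.codRestrict (derivSpan 0 F) fun x => ?_)
    (fun x y h => hΦ (congrArg Subtype.val h))
  obtain ⟨f, rfl⟩ := hπ x
  rw [hΦπ]
  exact act_mem_derivSpan (by simp) F

theorem hilbertFunction_add_derivSpan [IsLocalRing A] (hπ : Function.Surjective π)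
    (hΦ : Function.Injective Φ) (hΦπ : ∀ f, Φ (π f) = act f F) (i : ℕ) :
    hilbertFunction K A i + Module.finrank K (derivSpan (i + 1) F)
      = Module.finrank K (derivSpan i F) := by
  have := finite_of_presentation hπ hΦ hΦπ
  rw [← finrank_maxPow hπ hΦ hΦπ, ← finrank_maxPow hπ hΦ hΦπ, hilbertFunction_add]

theorem isLocalRing_of_presentation (hπ : Function.Surjective π)
    (hΦπ : ∀ f, Φ (π f) = act f F) (hF : F ≠ 0) : IsLocalRing A := by
  have : Nontrivial A := by
    refine ⟨1, 0, fun h => hF ?_⟩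
    have h1 := hΦπ 1
    rw [map_one, h, map_zero, ← MvPowerSeries.monomial_zero_one, act_monomial, one_smul,
      iterPartial_zero] at h1
    exact h1.symm
  exact IsLocalRing.of_surjective' (π : MvPowerSeries (Fin m) K →+* A) hπ

end Transport

/-- The hypothesis is independence modulo `S`; it makes the family independent and its span disjoint
from `S`. -/
theorem finrank_span_sup {K V ι : Type*} [Field K] [AddCommGroup V] [Module K V] [Fintype ι]
    (v : ι → V) (S : Submodule K V) [Module.Finite K S]
    (h : ∀ c : ι → K, ∑ i, c i • v i ∈ S → c = 0) :
    Module.finrank K ↥(Submodule.span K (Set.range v) ⊔ S) = Fintype.card ι + Module.finrank K S := by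
  have hli : LinearIndependent K v := by
    rw [Fintype.linearIndependent_iff]
    intro c hc i
    exact congrFun (h c (hc ▸ S.zero_mem)) i
  have hinf : Submodule.span K (Set.range v) ⊓ S = ⊥ := by
    rw [eq_bot_iff]
    rintro x ⟨hx, hxS⟩
    obtain ⟨c, rfl⟩ := (Submodule.mem_span_range_iff_exists_fun K).mp hx
    simp [h c hxS]
  have := Module.Finite.span_of_finite K (Set.finite_range v)
  have h2 := Submodule.finrank_sup_add_finrank_inf_eq (Submodule.span K (Set.range v)) S
  rwa [hinf, finrank_bot, add_zero, finrank_span_eq_card hli] at h2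

/-! ### Derivatives of polynomials of degree at most three -/

section Degree

variable {K : Type*} [Field K] {m : ℕ} {F : MvPolynomial (Fin m) K}

theorem derivSpan_zero_eq (F : MvPolynomial (Fin m) K) :
    derivSpan 0 F = Submodule.span K (Set.range fun _ : Fin 1 => F) ⊔ derivSpan 1 F := by
  apply le_antisymm
  · refine Submodule.span_le.mpr ?_
    rintro _ ⟨α, -, rfl⟩
    by_cases h : α = 0
    · subst h
      rw [iterPartial_zero]
      exact Submodule.mem_sup_left (Submodule.subset_span ⟨0, rfl⟩)
    · refine Submodule.mem_sup_right (iterPartial_mem_derivSpan ?_ F)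
      rw [Nat.one_le_iff_ne_zero, Ne, Finsupp.degree_eq_zero_iff]
      exact h
  · refine sup_le (Submodule.span_le.mpr ?_) (derivSpan_antitone F zero_le_one)
    rintro _ ⟨-, rfl⟩
    have := iterPartial_mem_derivSpan (Nat.zero_le (0 : Fin m →₀ ℕ).degree) F
    rwa [iterPartial_zero] at this

theorem exists_eq_add_single {α : Fin m →₀ ℕ} (h : α ≠ 0) :
    ∃ (i : Fin m) (β : Fin m →₀ ℕ), α = β + Finsupp.single i 1 := by
  obtain ⟨i, hi⟩ := Finsupp.ne_iff.mp h
  refine ⟨i, α - Finsupp.single i 1, (tsub_add_cancel_of_le ?_).symm⟩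
  rw [Finsupp.single_le_iff]
  exact Nat.one_le_iff_ne_zero.mpr hi

theorem exists_single_of_degree_eq_one {α : Fin m →₀ ℕ} (h : α.degree = 1) :
    ∃ i, α = Finsupp.single i 1 := by
  obtain ⟨i, β, rfl⟩ := exists_eq_add_single (α := α) (by rintro rfl; simp at h)
  have hβ : β.degree = 0 := by simpa using h
  exact ⟨i, by rw [(Finsupp.degree_eq_zero_iff β).mp hβ, zero_add]⟩

theorem derivSpan_one_eq (F : MvPolynomial (Fin m) K) :
    derivSpan 1 F =
      Submodule.span K (Set.range fun i => MvPolynomial.pderiv i F) ⊔ derivSpan 2 F := by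
  apply le_antisymm
  · refine Submodule.span_le.mpr ?_
    rintro _ ⟨α, hα, rfl⟩
    rcases hα.eq_or_lt with h | h
    · obtain ⟨i, rfl⟩ := exists_single_of_degree_eq_one h.symm
      rw [iterPartial_single_one]
      exact Submodule.mem_sup_left (Submodule.subset_span ⟨i, rfl⟩)
    · exact Submodule.mem_sup_right (iterPartial_mem_derivSpan h F)
  · refine sup_le (Submodule.span_le.mpr ?_) (derivSpan_antitone F one_le_two)
    rintro _ ⟨i, rfl⟩
    have := iterPartial_mem_derivSpan (i := 1) (α := Finsupp.single i 1) (by simp) F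
    rwa [iterPartial_single_one] at this

theorem coeff_eq_zero_of_mem_derivSpan {k : ℕ} (hF : ∀ β, k < β.degree → F.coeff β = 0)
    {i : ℕ} {G : MvPolynomial (Fin m) K} (hG : G ∈ derivSpan i F) {β : Fin m →₀ ℕ}
    (hβ : k < β.degree + i) : G.coeff β = 0 := by
  induction hG using Submodule.span_induction with
  | mem x hx =>
    obtain ⟨α, hα, rfl⟩ := hx
    rw [coeff_iterPartial, hF, zero_mul]
    rw [map_add]
    omega
  | zero => simp
  | add x y _ _ hx hy => rw [MvPolynomial.coeff_add, hx, hy, add_zero]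
  | smul c x _ hx => rw [MvPolynomial.coeff_smul, hx, smul_zero]

theorem eq_C_of_coeff_eq_zero {G : MvPolynomial (Fin m) K}
    (h : ∀ β, 0 < β.degree → G.coeff β = 0) : G = MvPolynomial.C (G.coeff 0) := by
  classical
  ext β
  rw [MvPolynomial.coeff_C]
  split_ifs with hβ
  · rw [hβ]
  · exact h β (Nat.pos_of_ne_zero fun h0 => hβ ((Finsupp.degree_eq_zero_iff β).mp h0).symm)

theorem coeff_single_one (k : Fin m) (G : MvPolynomial (Fin m) K) :
    G.coeff (Finsupp.single k 1) = (MvPolynomial.pderiv k G).coeff 0 := by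
  classical
  rw [← iterPartial_single_one, coeff_zero_iterPartial, Finset.prod_eq_one, mul_one]
  intro i _
  rw [Finsupp.single_apply]
  split_ifs <;> simp

theorem eq_linear_of_coeff_eq_zero {G : MvPolynomial (Fin m) K}
    (h : ∀ β, 1 < β.degree → G.coeff β = 0) :
    G = G.coeff 0 • 1 + ∑ k, G.coeff (Finsupp.single k 1) • MvPolynomial.X k := by
  classical
  ext β
  simp only [MvPolynomial.coeff_add, MvPolynomial.coeff_smul, MvPolynomial.coeff_sum,
    MvPolynomial.coeff_X, MvPolynomial.coeff_one, smul_eq_mul, mul_ite, mul_one, mul_zero]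
  rcases Nat.lt_trichotomy β.degree 1 with h1 | h1 | h1
  · have : β = 0 := (Finsupp.degree_eq_zero_iff β).mp (by omega)
    subst this
    simp
  · obtain ⟨i, rfl⟩ := exists_single_of_degree_eq_one h1
    simp [Finsupp.single_left_inj, eq_comm]
  · rw [h β h1, if_neg, zero_add, Finset.sum_eq_zero]
    · intro k _
      rw [if_neg]
      rintro rfl
      simp at h1
    · rintro rfl
      simp at h1

theorem derivSpan_four_eq_bot (hF : ∀ β, 3 < β.degree → F.coeff β = 0) {i : ℕ} (hi : 4 ≤ i) :
    derivSpan i F = ⊥ := by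
  rw [eq_bot_iff]
  intro G hG
  rw [Submodule.mem_bot]
  ext β
  exact coeff_eq_zero_of_mem_derivSpan hF hG (by omega)

theorem derivSpan_three_eq [CharZero K] (hF : ∀ β, 3 < β.degree → F.coeff β = 0)
    {γ : Fin m →₀ ℕ} (hγ : γ.degree = 3) (hFγ : F.coeff γ ≠ 0) :
    derivSpan 3 F = Submodule.span K {1} := by
  have key : ∀ G ∈ derivSpan 3 F, G = MvPolynomial.C (G.coeff 0) := fun G hG =>
    eq_C_of_coeff_eq_zero fun β hβ => coeff_eq_zero_of_mem_derivSpan hF hG (by omega)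
  apply le_antisymm
  · intro G hG
    rw [key G hG, Submodule.mem_span_singleton]
    exact ⟨G.coeff 0, by rw [MvPolynomial.smul_eq_C_mul, mul_one]⟩
  · rw [Submodule.span_singleton_le_iff_mem]
    have h := iterPartial_mem_derivSpan hγ.ge F
    have hc : (iterPartial γ F).coeff 0 ≠ 0 := by
      rw [coeff_zero_iterPartial]
      refine mul_ne_zero hFγ (Finset.prod_ne_zero_iff.mpr fun i _ => ?_)
      exact_mod_cast Nat.factorial_ne_zero _
    have := Submodule.smul_mem _ ((iterPartial γ F).coeff 0)⁻¹ h
    rwa [key _ h, MvPolynomial.coeff_C, if_pos rfl, MvPolynomial.smul_eq_C_mul, ← map_mul,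
      inv_mul_cancel₀ hc, MvPolynomial.C_1] at this

theorem finrank_derivSpan_zero (hF : ∀ β, 3 < β.degree → F.coeff β = 0)
    {γ : Fin m →₀ ℕ} (hγ : γ.degree = 3) (hFγ : F.coeff γ ≠ 0) :
    Module.finrank K (derivSpan 0 F) = 1 + Module.finrank K (derivSpan 1 F) := by
  rw [derivSpan_zero_eq, finrank_span_sup, Fintype.card_fin]
  intro c hc
  -- Proper derivatives have degree at most 2, so a multiple of F among them has no y^γ term.
  have h := coeff_eq_zero_of_mem_derivSpan hF hc (β := γ) (by omega)
  simp only [Finset.univ_unique, Fin.default_eq_zero, Finset.sum_singleton, MvPolynomial.coeff_smul,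
    smul_eq_mul, mul_eq_zero, hFγ, or_false] at h
  ext i
  rw [Subsingleton.elim i 0, h]
  rfl

theorem pderiv_coeff_eq_zero {k : ℕ} (hF : F.IsHomogeneous (k + 1)) (i : Fin m) {β : Fin m →₀ ℕ}
    (hβ : β.degree ≠ k) : (MvPolynomial.pderiv i F).coeff β = 0 := by
  rw [← iterPartial_single_one, coeff_iterPartial, hF.coeff_eq_zero, zero_mul]
  simpa using hβ

theorem exists_coeff_ne_zero_of_isHomogeneous {k : ℕ} (hF : F.IsHomogeneous k) (h0 : F ≠ 0) :
    ∃ γ : Fin m →₀ ℕ, γ.degree = k ∧ F.coeff γ ≠ 0 := by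
  obtain ⟨γ, hγ⟩ := MvPolynomial.ne_zero_iff.mp h0
  refine ⟨γ, ?_, hγ⟩
  by_contra h
  exact hγ (hF.coeff_eq_zero h)

end Degree

/-! ### Non-degeneracy as independence of the first partials -/

section Nondegenerate

variable {K : Type*} [Field K] {m : ℕ} {F : MvPolynomial (Fin m) K}

theorem isNondegenerate_of_linearIndependent (hF : F.IsHomogeneous 3) (h0 : F ≠ 0)
    (hli : LinearIndependent K fun i => MvPolynomial.pderiv i F) : IsNondegenerate F := by
  obtain ⟨π, Φ, hπ, hΦ, hΦπ⟩ := exists_presentation (AlgEquiv.refl : algebraOf F ≃ₐ[K] _)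
  have hloc := isLocalRing_of_presentation hπ hΦπ h0
  refine ⟨hloc, ?_⟩
  have h := hilbertFunction_add_derivSpan hπ hΦ hΦπ 1
  rw [derivSpan_one_eq, finrank_span_sup, Fintype.card_fin] at h
  · exact Nat.add_right_cancel h
  intro c hc
  have hdeg : ∀ β : Fin m →₀ ℕ, 3 < β.degree → F.coeff β = 0 := fun β hβ =>
    hF.coeff_eq_zero (by omega)
  -- The combination is a quadratic form, whereas second and higher derivatives of a cubic have
  -- degree at most 1.
  have hz : ∑ i, c i • MvPolynomial.pderiv i F = 0 := by
    ext β
    by_cases hβ : β.degree = 2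
    · exact coeff_eq_zero_of_mem_derivSpan hdeg hc (by omega)
    · rw [MvPolynomial.coeff_sum, MvPolynomial.coeff_zero]
      refine Finset.sum_eq_zero fun i _ => ?_
      rw [MvPolynomial.coeff_smul, pderiv_coeff_eq_zero hF i hβ, smul_zero]
  funext i
  exact Fintype.linearIndependent_iff.mp hli c hz i

theorem IsNondegenerate.ne_zero (h : IsNondegenerate F) : F ≠ 0 := by
  rintro rfl
  obtain ⟨hloc, -⟩ := h
  obtain ⟨π, Φ, hπ, hΦ, hΦπ⟩ := exists_presentation
    (AlgEquiv.refl : algebraOf (0 : MvPolynomial (Fin m) K) ≃ₐ[K] _)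
  apply one_ne_zero (α := algebraOf (0 : MvPolynomial (Fin m) K))
  apply hΦ
  rw [map_zero, ← map_one π, hΦπ, act_zero_right]

/-- The m first partials must raise the dimension by m over `derivSpan 2 F`, which forces their span
to have dimension m. -/
theorem IsNondegenerate.linearIndependent (h : IsNondegenerate F) :
    LinearIndependent K fun i => MvPolynomial.pderiv i F := by
  obtain ⟨hloc, h⟩ := h
  obtain ⟨π, Φ, hπ, hΦ, hΦπ⟩ := exists_presentation (AlgEquiv.refl : algebraOf F ≃ₐ[K] _)
  have h1 := hilbertFunction_add_derivSpan hπ hΦ hΦπ 1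
  rw [h, derivSpan_one_eq] at h1
  have := Module.Finite.span_of_finite K (Set.finite_range fun i => MvPolynomial.pderiv i F)
  have h2 := Submodule.finrank_add_le_finrank_add_finrank
    (Submodule.span K (Set.range fun i => MvPolynomial.pderiv i F)) (derivSpan 2 F)
  rw [linearIndependent_iff_card_le_finrank_span, Fintype.card_fin, Set.finrank]
  change m + Module.finrank K (derivSpan 2 F) = _ at h1
  omega

end Nondegenerate

/-! ### The socle of A_F -/

section Socle

variable {K : Type*} [Field K] {m : ℕ} {A : Type*} [CommRing A] [Algebra K A]
  {F : MvPolynomial (Fin m) K} {π : MvPowerSeries (Fin m) K →ₐ[K] A}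
  {Φ : A →ₗ[K] MvPolynomial (Fin m) K}

/-- Multiplication by x_i becomes ∂_i, so the socle maps onto the polynomials in the image killed by
every ∂_i. In characteristic zero these are the constants, and `h1` puts them in the image. -/
theorem finrank_socle [CharZero K] [IsLocalRing A] (hπ : Function.Surjective π)
    (hΦ : Function.Injective Φ) (hΦπ : ∀ f, Φ (π f) = act f F)
    (h1 : (1 : MvPolynomial (Fin m) K) ∈ derivSpan 0 F) :
    Module.finrank K ↥((⊥ : Ideal A).colon (IsLocalRing.maximalIdeal A : Set A)) = 1 := by
  have hmul : ∀ g x, Φ (π g * x) = act g (Φ x) := fun g x => by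
    obtain ⟨f, rfl⟩ := hπ x
    rw [← map_mul, hΦπ, hΦπ, act_mul]
  have hmap : (((⊥ : Ideal A).colon (IsLocalRing.maximalIdeal A : Set A)).restrictScalars K).map Φ
      = Submodule.span K {1} := by
    apply le_antisymm
    · rintro _ ⟨x, hx, rfl⟩
      have hx' : x ∈ (⊥ : Ideal A).colon (IsLocalRing.maximalIdeal A : Set A) := hx
      rw [Submodule.mem_colon] at hx'
      have hd : ∀ i, MvPolynomial.pderiv i (Φ x) = 0 := fun i => by
        have hX : π (MvPowerSeries.monomial (Finsupp.single i 1) 1)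
            ∈ IsLocalRing.maximalIdeal A := by
          have h := maximalIdeal_pow_eq_map hπ 1
          rw [pow_one, pow_one] at h
          rw [h]
          refine Ideal.mem_map_of_mem π ((mem_maximalIdeal_iff _).mpr ?_)
          exact MvPowerSeries.constantCoeff_X i
        have h := hx' _ hX
        rw [smul_eq_mul, mul_comm, Submodule.mem_bot] at h
        have h2 := hmul (MvPowerSeries.monomial (Finsupp.single i 1) 1) x
        rwa [h, map_zero, act_monomial, one_smul, iterPartial_single_one, eq_comm] at h2
      have hC : Φ x = MvPolynomial.C ((Φ x).coeff 0) := by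
        refine eq_C_of_coeff_eq_zero fun β hβ => ?_
        obtain ⟨i, hi⟩ : ∃ i, β i ≠ 0 := by
          by_contra! hcon
          have : β = 0 := by ext j; exact hcon j
          simp [this] at hβ
        have h := congrArg (MvPolynomial.coeff (β - Finsupp.single i 1)) (hd i)
        rw [← iterPartial_single_one, coeff_iterPartial, MvPolynomial.coeff_zero, mul_eq_zero,
          tsub_add_cancel_of_le (Finsupp.single_le_iff.mpr (by omega))] at h
        exact h.resolve_right (prod_descFactorial_ne_zero _ _)
      rw [hC, Submodule.mem_span_singleton]
      exact ⟨_, by rw [MvPolynomial.smul_eq_C_mul, mul_one]⟩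
    · rw [Submodule.span_singleton_le_iff_mem]
      rw [← map_maxPow hπ hΦπ] at h1
      obtain ⟨x, -, hx⟩ := h1
      refine ⟨x, ?_, hx⟩
      change x ∈ (⊥ : Ideal A).colon (IsLocalRing.maximalIdeal A : Set A)
      rw [Submodule.mem_colon]
      intro s hs
      have h := maximalIdeal_pow_eq_map hπ 1
      rw [pow_one, pow_one] at h
      rw [SetLike.mem_coe, h, Ideal.mem_map_iff_of_surjective _ hπ] at hs
      obtain ⟨g, hg, rfl⟩ := hs
      rw [smul_eq_mul, mul_comm, Submodule.mem_bot]
      apply hΦ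
      rw [hmul, hx, map_zero]
      have h2 := act_mem_derivSpan (i := 1) (by rwa [pow_one]) (1 : MvPolynomial (Fin m) K)
      ext β
      refine coeff_eq_zero_of_mem_derivSpan (k := 0) (fun β hβ => ?_) h2 (by omega)
      classical
      rw [MvPolynomial.coeff_one, if_neg]
      rintro rfl
      simp at hβ
  have h2 := (Submodule.equivMapOfInjective Φ hΦ
    (((⊥ : Ideal A).colon (IsLocalRing.maximalIdeal A : Set A)).restrictScalars K)).finrank_eq
  rw [hmap, finrank_span_singleton one_ne_zero] at h2
  exact h2

end Socle

/-! ### A cubic plus squares has Hilbert function {1, n + d, n, 1} -/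

section SumOfSquares

variable {K : Type*} [Field K] {n d : ℕ}

/-- `F₃ + y_{n+1}^2 + ⋯ + y_{n+d}^2`. -/
def addSquares (d : ℕ) (F₃ : MvPolynomial (Fin n) K) : MvPolynomial (Fin (n + d)) K :=
  MvPolynomial.rename (Fin.castAdd d) F₃ + ∑ j : Fin d, MvPolynomial.X (Fin.natAdd n j) ^ 2

theorem rename_castLE_add_sum_filter (h : n ≤ n + d) (F₃ : MvPolynomial (Fin n) K) :
    MvPolynomial.rename (Fin.castLE h) F₃ +
        ∑ j ∈ Finset.univ.filter (fun j : Fin (n + d) => n ≤ (j : ℕ)),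
          (MvPolynomial.X j : MvPolynomial (Fin (n + d)) K) ^ 2 = addSquares d F₃ := by
  unfold addSquares
  congr 1
  rw [Finset.sum_filter, Fin.sum_univ_add, Finset.sum_eq_zero, zero_add]
  · exact Finset.sum_congr rfl fun j _ => if_pos (by simp)
  · exact fun i _ => if_neg (by simp)

variable {F₃ : MvPolynomial (Fin n) K}

theorem isHomogeneous_sum_sq :
    (∑ j : Fin d, (MvPolynomial.X (Fin.natAdd n j) : MvPolynomial (Fin (n + d)) K) ^ 2).IsHomogeneous
      2 :=
  MvPolynomial.IsHomogeneous.sum _ _ _ fun _ _ => by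
    simpa using (MvPolynomial.isHomogeneous_X K _).pow 2

theorem coeff_addSquares_eq_zero (hF : F₃.IsHomogeneous 3) {β : Fin (n + d) →₀ ℕ}
    (h2 : β.degree ≠ 2) (h3 : β.degree ≠ 3) : (addSquares d F₃).coeff β = 0 := by
  rw [addSquares, MvPolynomial.coeff_add, hF.rename_isHomogeneous.coeff_eq_zero h3,
    isHomogeneous_sum_sq.coeff_eq_zero h2, add_zero]

theorem coeff_addSquares_mapDomain (β : Fin n →₀ ℕ) (h2 : β.degree ≠ 2) :
    (addSquares d F₃).coeff (β.mapDomain (Fin.castAdd d)) = F₃.coeff β := by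
  rw [addSquares, MvPolynomial.coeff_add,
    MvPolynomial.coeff_rename_mapDomain _ (Fin.castAdd_injective n d),
    isHomogeneous_sum_sq.coeff_eq_zero (by rwa [Finsupp.degree_mapDomain]), add_zero]

theorem pderiv_castAdd_addSquares (i : Fin n) :
    MvPolynomial.pderiv (Fin.castAdd d i) (addSquares d F₃)
      = MvPolynomial.rename (Fin.castAdd d) (MvPolynomial.pderiv i F₃) := by
  rw [addSquares, map_add, MvPolynomial.pderiv_rename (Fin.castAdd_injective n d), map_sum,
    Finset.sum_eq_zero, add_zero]
  intro j _
  rw [MvPolynomial.pderiv_pow, MvPolynomial.pderiv_X_of_ne, mul_zero]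
  intro h
  have := congrArg Fin.val h
  simp at this
  omega

theorem pderiv_natAdd_addSquares (j : Fin d) :
    MvPolynomial.pderiv (Fin.natAdd n j) (addSquares d F₃)
      = (2 : K) • MvPolynomial.X (Fin.natAdd n j) := by
  classical
  rw [addSquares, map_add, MvPolynomial.pderiv_eq_zero_of_notMem_vars, zero_add, map_sum,
    Finset.sum_eq_single j]
  · rw [MvPolynomial.pderiv_pow, MvPolynomial.pderiv_X_self, MvPolynomial.smul_eq_C_mul]
    simp [← map_ofNat MvPolynomial.C 2]
  · intro k _ hk
    rw [MvPolynomial.pderiv_pow, MvPolynomial.pderiv_X_of_ne, mul_zero]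
    exact fun h => hk (Fin.natAdd_injective _ _ h)
  · simp
  · intro h
    obtain ⟨k, -, hk⟩ := Finset.mem_image.mp (MvPolynomial.vars_rename _ _ h)
    have := congrArg Fin.val hk
    simp at this
    omega

/-- Both sides are the constant term of ∂_k ∂^α G. This is the symmetry between first derivatives
and linear parts of higher ones. -/
theorem coeff_single_iterPartial (k : Fin (n + d)) (α : Fin (n + d) →₀ ℕ)
    (G : MvPolynomial (Fin (n + d)) K) :
    (iterPartial α G).coeff (Finsupp.single k 1)
      = (MvPolynomial.pderiv k G).coeff α * ∏ i, ((α i).factorial : K) := by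
  rw [coeff_single_one, ← iterPartial_single_one, iterPartial_comm, coeff_zero_iterPartial,
    iterPartial_single_one]

/-- Up to constants, the second derivatives see only the cubic. Their linear parts are the rows of a
matrix whose columns are, up to factorials, the coefficients of the ∂_i F₃, so independence of these
columns makes the rows span all n variables. -/
theorem derivSpan_two_addSquares [CharZero K] (hF : F₃.IsHomogeneous 3)
    (hli : LinearIndependent K fun i => MvPolynomial.pderiv i F₃)
    (h3 : derivSpan 3 (addSquares d F₃) = Submodule.span K {1}) :
    derivSpan 2 (addSquares d F₃) =
      Submodule.span K (Set.range fun i : Fin n => MvPolynomial.X (Fin.castAdd d i)) ⊔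
        derivSpan 3 (addSquares d F₃) := by
  have hdeg : ∀ β, 3 < β.degree → (addSquares d F₃).coeff β = 0 := fun β hβ =>
    coeff_addSquares_eq_zero hF (by omega) (by omega)
  have expand : ∀ α : Fin (n + d) →₀ ℕ, α.degree = 2 → iterPartial α (addSquares d F₃) =
      (iterPartial α (addSquares d F₃)).coeff 0 • 1 +
      ∑ i : Fin n, ((MvPolynomial.rename (Fin.castAdd d) (MvPolynomial.pderiv i F₃)).coeff α *
        ∏ i, ((α i).factorial : K)) • MvPolynomial.X (Fin.castAdd d i) := by
    intro α hα
    have h1 := eq_linear_of_coeff_eq_zero (G := iterPartial α (addSquares d F₃)) fun β hβ =>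
      coeff_eq_zero_of_mem_derivSpan hdeg (iterPartial_mem_derivSpan hα.ge _) (by omega)
    refine h1.trans ?_
    congr 1
    rw [Fin.sum_univ_add]
    conv_rhs => rw [← add_zero (∑ i : Fin n, _)]
    congr 1
    · refine Finset.sum_congr rfl fun i _ => ?_
      rw [coeff_single_iterPartial, pderiv_castAdd_addSquares]
    · refine Finset.sum_eq_zero fun j _ => ?_
      rw [coeff_single_iterPartial, pderiv_natAdd_addSquares, MvPolynomial.coeff_smul,
        (MvPolynomial.isHomogeneous_X K _).coeff_eq_zero (by omega), smul_zero, zero_mul, zero_smul]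
  have hone : (1 : MvPolynomial (Fin (n + d)) K) ∈ derivSpan 3 (addSquares d F₃) := by
    rw [h3]; exact Submodule.mem_span_singleton_self 1
  apply le_antisymm
  · refine Submodule.span_le.mpr ?_
    rintro _ ⟨α, hα, rfl⟩
    rcases hα.eq_or_lt with h | h
    · rw [expand α h.symm, add_comm (_ • (1 : MvPolynomial (Fin (n + d)) K))]
      refine Submodule.add_mem_sup (Submodule.sum_mem _ fun i _ => Submodule.smul_mem _ _
        (Submodule.subset_span ⟨i, rfl⟩)) (Submodule.smul_mem _ _ hone)
    · exact Submodule.mem_sup_right (iterPartial_mem_derivSpan h _)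
  · have hle := derivSpan_antitone (addSquares d F₃) (show 2 ≤ 3 by norm_num)
    refine sup_le (Submodule.span_le.mpr ?_) hle
    rintro _ ⟨i₀, rfl⟩
    -- Duality: a functional killing `derivSpan 2` but not y_{i₀} has values on the variables that
    -- form a nontrivial relation among the ∂_i F₃.
    by_contra hX
    obtain ⟨f, hf, hf0⟩ := Submodule.exists_dual_map_eq_bot_of_notMem hX inferInstance
    have hfD : ∀ G ∈ derivSpan 2 (addSquares d F₃), f G = 0 := fun G hG => by
      have : f G ∈ Submodule.map f (derivSpan 2 (addSquares d F₃)) := ⟨G, hG, rfl⟩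
      rwa [hf0, Submodule.mem_bot] at this
    refine hf (Fintype.linearIndependent_iff.mp hli
      (fun i => f (MvPolynomial.X (Fin.castAdd d i))) ?_ i₀)
    ext β
    rw [MvPolynomial.coeff_sum, MvPolynomial.coeff_zero]
    by_cases hβ : β.degree = 2
    · have hα : (β.mapDomain (Fin.castAdd d)).degree = 2 := by rwa [Finsupp.degree_mapDomain]
      have h := hfD _ (iterPartial_mem_derivSpan hα.ge _)
      rw [expand _ hα, map_add, map_smul, hfD 1 (hle hone), smul_zero, zero_add, map_sum] at h
      simp only [map_smul, smul_eq_mul,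
        MvPolynomial.coeff_rename_mapDomain _ (Fin.castAdd_injective n d)] at h
      have hne : ∏ i, (((β.mapDomain (Fin.castAdd d)) i).factorial : K) ≠ 0 :=
        Finset.prod_ne_zero_iff.mpr fun i _ => by exact_mod_cast Nat.factorial_ne_zero _
      apply mul_right_cancel₀ hne
      rw [zero_mul, Finset.sum_mul, ← h]
      refine Finset.sum_congr rfl fun i _ => ?_
      rw [MvPolynomial.coeff_smul, smul_eq_mul]
      ring
    · refine Finset.sum_eq_zero fun i _ => ?_
      rw [MvPolynomial.coeff_smul, pderiv_coeff_eq_zero hF i hβ, smul_zero]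

theorem finrank_derivSpan_two_addSquares [CharZero K] (hF : F₃.IsHomogeneous 3)
    (hli : LinearIndependent K fun i => MvPolynomial.pderiv i F₃)
    (h3 : derivSpan 3 (addSquares d F₃) = Submodule.span K {1}) :
    Module.finrank K (derivSpan 2 (addSquares d F₃)) =
      n + Module.finrank K (derivSpan 3 (addSquares d F₃)) := by
  classical
  rw [derivSpan_two_addSquares hF hli h3, finrank_span_sup, Fintype.card_fin]
  intro c hc
  rw [h3, Submodule.mem_span_singleton] at hc
  obtain ⟨a, ha⟩ := hc
  funext i
  have h := congrArg (MvPolynomial.coeff (Finsupp.single (Fin.castAdd d i) 1)) ha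
  simp only [MvPolynomial.coeff_smul, MvPolynomial.coeff_sum, MvPolynomial.coeff_X,
    MvPolynomial.coeff_one, smul_eq_mul] at h
  simpa [Finsupp.single_left_inj, eq_comm] using h

theorem finrank_derivSpan_one_addSquares [CharZero K] (hF : F₃.IsHomogeneous 3)
    (hli : LinearIndependent K fun i => MvPolynomial.pderiv i F₃)
    (h3 : derivSpan 3 (addSquares d F₃) = Submodule.span K {1}) :
    Module.finrank K (derivSpan 1 (addSquares d F₃)) =
      n + d + Module.finrank K (derivSpan 2 (addSquares d F₃)) := by
  classical
  have hdeg : ∀ β, 3 < β.degree → (addSquares d F₃).coeff β = 0 := fun β hβ =>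
    coeff_addSquares_eq_zero hF (by omega) (by omega)
  rw [derivSpan_one_eq, finrank_span_sup, Fintype.card_fin]
  intro c hc
  have hsum : ∑ i, c i • MvPolynomial.pderiv i (addSquares d F₃) =
      MvPolynomial.rename (Fin.castAdd d)
        (∑ i, c (Fin.castAdd d i) • MvPolynomial.pderiv i F₃) +
      ∑ j, (c (Fin.natAdd n j) * 2) • MvPolynomial.X (Fin.natAdd n j) := by
    rw [Fin.sum_univ_add, map_sum]
    simp only [pderiv_castAdd_addSquares, pderiv_natAdd_addSquares, map_smul, mul_smul]
  -- Quadratic part of the relation: the squares contribute only linear terms, and `derivSpan 2` has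
  -- degree at most 1.
  have hcubic : ∑ i, c (Fin.castAdd d i) • MvPolynomial.pderiv i F₃ = 0 := by
    ext β
    rw [MvPolynomial.coeff_zero]
    by_cases hβ : β.degree = 2
    · have hα : (β.mapDomain (Fin.castAdd d)).degree = 2 := by rwa [Finsupp.degree_mapDomain]
      have h := coeff_eq_zero_of_mem_derivSpan hdeg hc
        (β := β.mapDomain (Fin.castAdd d)) (by omega)
      have hlin : (∑ j : Fin d, (c (Fin.natAdd n j) * 2) •
          (MvPolynomial.X (Fin.natAdd n j) : MvPolynomial (Fin (n + d)) K)).coeff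
            (β.mapDomain (Fin.castAdd d)) = 0 := by
        rw [MvPolynomial.coeff_sum]
        refine Finset.sum_eq_zero fun j _ => ?_
        rw [MvPolynomial.coeff_smul, (MvPolynomial.isHomogeneous_X K _).coeff_eq_zero (by omega),
          smul_zero]
      rw [hsum, MvPolynomial.coeff_add,
        MvPolynomial.coeff_rename_mapDomain _ (Fin.castAdd_injective n d), hlin, add_zero] at h
      exact h
    · rw [MvPolynomial.coeff_sum]
      refine Finset.sum_eq_zero fun i _ => ?_
      rw [MvPolynomial.coeff_smul, pderiv_coeff_eq_zero hF i hβ, smul_zero]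
  -- What remains is linear in the square variables but lies in the span of 1 and the cubic
  -- variables, so it vanishes.
  rw [hsum, hcubic, map_zero, zero_add, derivSpan_two_addSquares hF hli h3, h3,
    Submodule.mem_sup] at hc
  obtain ⟨x, hx, y, hy, hxy⟩ := hc
  obtain ⟨e, rfl⟩ := (Submodule.mem_span_range_iff_exists_fun K).mp hx
  obtain ⟨a, rfl⟩ := Submodule.mem_span_singleton.mp hy
  funext i
  refine Fin.addCases (fun i => ?_) (fun j => ?_) i
  · exact Fintype.linearIndependent_iff.mp hli (fun i => c (Fin.castAdd d i)) hcubic i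
  · have h := congrArg (MvPolynomial.coeff (Finsupp.single (Fin.natAdd n j) 1)) hxy
    have hne : ∀ k : Fin n, Fin.castAdd d k ≠ Fin.natAdd n j := fun k hk => by
      have := congrArg Fin.val hk
      simp at this
      omega
    simp only [MvPolynomial.coeff_smul, MvPolynomial.coeff_sum, MvPolynomial.coeff_add,
      MvPolynomial.coeff_X, MvPolynomial.coeff_one, smul_eq_mul] at h
    simpa [Finsupp.single_left_inj, hne, eq_comm] using h

theorem gorenstein_of_algEquiv_addSquares [CharZero K] {A : Type*} [CommRing A] [Algebra K A]
    (hF : F₃.IsHomogeneous 3) (hnd : IsNondegenerate F₃) (e : A ≃ₐ[K] algebraOf (addSquares d F₃)) :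
    ∃ _ : IsLocalRing A, IsArtinianGorenstein K A ∧
      ∀ i : ℕ, hilbertFunction K A i = ([1, n + d, n, 1] : List ℕ).getD i 0 := by
  have hdeg : ∀ β, 3 < β.degree → (addSquares d F₃).coeff β = 0 := fun β hβ =>
    coeff_addSquares_eq_zero hF (by omega) (by omega)
  obtain ⟨γ, hγ, hFγ⟩ := exists_coeff_ne_zero_of_isHomogeneous hF hnd.ne_zero
  have hγ' : (γ.mapDomain (Fin.castAdd d)).degree = 3 := by rwa [Finsupp.degree_mapDomain]
  have hFγ' : (addSquares d F₃).coeff (γ.mapDomain (Fin.castAdd d)) ≠ 0 := by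
    rwa [coeff_addSquares_mapDomain γ (by omega)]
  have hli := hnd.linearIndependent
  have h3 := derivSpan_three_eq hdeg hγ' hFγ'
  have r3 : Module.finrank K (derivSpan 3 (addSquares d F₃)) = 1 := by
    rw [h3, finrank_span_singleton one_ne_zero]
  have r2 := finrank_derivSpan_two_addSquares hF hli h3
  have r1 := finrank_derivSpan_one_addSquares hF hli h3
  have r0 := finrank_derivSpan_zero hdeg hγ' hFγ'
  have r4 : ∀ i, 4 ≤ i → Module.finrank K (derivSpan i (addSquares d F₃)) = 0 := fun i hi => by
    rw [derivSpan_four_eq_bot hdeg hi, finrank_bot]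
  obtain ⟨π, Φ, hπ, hΦ, hΦπ⟩ := exists_presentation e
  have h0 : addSquares d F₃ ≠ 0 := fun h => hFγ' (by rw [h, MvPolynomial.coeff_zero])
  have hloc := isLocalRing_of_presentation hπ hΦπ h0
  have hfin := finite_of_presentation hπ hΦ hΦπ
  have hHF := hilbertFunction_add_derivSpan hπ hΦ hΦπ
  refine ⟨hloc, ⟨IsArtinianRing.of_finite K A, finrank_socle hπ hΦ hΦπ ?_⟩, fun i => ?_⟩
  · refine derivSpan_antitone _ (Nat.zero_le 3) ?_
    change (1 : MvPolynomial (Fin (n + d)) K) ∈ derivSpan 3 _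
    rw [h3]
    exact Submodule.mem_span_singleton_self 1
  · have h := hHF i
    match i with
    | 0 => simp at h ⊢; omega
    | 1 => simp at h ⊢; omega
    | 2 => simp at h ⊢; omega
    | 3 =>
      rw [r3, r4 _ (by omega)] at h
      simpa using h
    | i + 4 =>
      rw [r4 _ (by omega), r4 _ (by omega)] at h
      simpa using h

end SumOfSquares

/-! ### Recovering the polynomial from the moments of a functional -/

section Kernel

variable {K : Type*} [Field K] {m : ℕ} {A : Type*} [CommRing A] [Algebra K A]

theorem coeff_zero_act_coe {F : MvPolynomial (Fin m) K} {a : Fin m → A} {φ : A →ₗ[K] K}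
    (hφ : ∀ α : Fin m →₀ ℕ, φ (∏ i, a i ^ α i) = (iterPartial α F).coeff 0)
    (p : MvPolynomial (Fin m) K) :
    (act (p : MvPowerSeries (Fin m) K) F).coeff 0 = φ (MvPolynomial.aeval a p) := by
  induction p using MvPolynomial.induction_on' with
  | monomial α c =>
    rw [MvPolynomial.coe_monomial, act_monomial, MvPolynomial.aeval_monomial,
      ← Algebra.smul_def, map_smul, Finsupp.prod_fintype _ _ (fun i => pow_zero _), hφ,
      MvPolynomial.coeff_smul]
  | add p q hp hq => rw [MvPolynomial.coe_add, act_add_left, MvPolynomial.coeff_add, hp, hq,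
      map_add, map_add]

/-- An algebra with generators `a` and a nondegenerate functional `φ` is the algebra of the
polynomial whose coefficients are the (divided) moments of `φ`. -/
theorem nonempty_algEquiv_algebraOf [CharZero K] {F : MvPolynomial (Fin m) K} {a : Fin m → A}
    {φ : A →ₗ[K] K}
    (hφ : ∀ α : Fin m →₀ ℕ, φ (∏ i, a i ^ α i) = (iterPartial α F).coeff 0)
    (ha : Function.Surjective (MvPolynomial.aeval a : MvPolynomial (Fin m) K →ₐ[K] A))
    (hnd : ∀ x, (∀ y, φ (x * y) = 0) → x = 0) : Nonempty (A ≃ₐ[K] algebraOf F) := by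
  let ρ : MvPolynomial (Fin m) K →ₐ[K] algebraOf F :=
    (Ideal.Quotient.mkₐ K (ann F)).comp (MvPolynomial.coeToMvPowerSeries.algHom K)
  have hρ_apply : ∀ p, ρ p = Ideal.Quotient.mk (ann F) (p : MvPowerSeries (Fin m) K) := fun p => by
    simp [ρ, MvPolynomial.coeToMvPowerSeries.algHom_apply]
  have hρ : Function.Surjective ρ := by
    intro x
    obtain ⟨f, rfl⟩ := Ideal.Quotient.mk_surjective x
    -- Truncating f to the finitely many exponents with nonzero partial does not change f ∘ F, so
    -- polynomials already surject onto A_F.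
    let D := (finite_iterPartial_ne_zero F).toFinset
    refine ⟨∑ α ∈ D, MvPolynomial.monomial α (MvPowerSeries.coeff α f), ?_⟩
    rw [hρ_apply, Ideal.Quotient.mk_eq_mk_iff_sub_mem, mem_ann_iff]
    classical
    unfold act
    rw [finsum_eq_zero_of_forall_eq_zero]
    intro β
    by_cases hβ : iterPartial β F = 0
    · rw [hβ, smul_zero]
    · rw [map_sub, MvPolynomial.coeff_coe, MvPolynomial.coeff_sum, Finset.sum_eq_single β,
        MvPolynomial.coeff_monomial, if_pos rfl, sub_self, zero_smul]
      · intro α _ hα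
        rw [MvPolynomial.coeff_monomial, if_neg hα]
      · intro h
        exact absurd ((Set.Finite.mem_toFinset _).mpr hβ) h
  have hker : RingHom.ker (MvPolynomial.aeval a : MvPolynomial (Fin m) K →ₐ[K] A)
      = RingHom.ker ρ := by
    ext p
    rw [RingHom.mem_ker, RingHom.mem_ker, hρ_apply, Ideal.Quotient.eq_zero_iff_mem, mem_ann_iff]
    constructor
    · intro h
      ext β
      -- The β-coefficient of p ∘ F is, up to β!, the constant term of (x^β p) ∘ F, which φ
      -- computes.
      have h2 := coeff_zero_act_coe hφ (MvPolynomial.monomial β 1 * p)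
      rw [map_mul, h, mul_zero, map_zero, MvPolynomial.coe_mul, act_mul, MvPolynomial.coe_monomial,
        act_monomial, one_smul, coeff_zero_iterPartial] at h2
      exact (mul_eq_zero.mp h2).resolve_right
        (Finset.prod_ne_zero_iff.mpr fun i _ => by exact_mod_cast Nat.factorial_ne_zero _)
    · intro h
      refine hnd _ fun y => ?_
      obtain ⟨q, rfl⟩ := ha y
      rw [← map_mul, ← coeff_zero_act_coe hφ, mul_comm, MvPolynomial.coe_mul, act_mul, h,
        act_zero_right, MvPolynomial.coeff_zero]
  exact ⟨(Ideal.quotientKerAlgEquivOfSurjective ha).symm.trans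
    ((Ideal.quotientEquivAlgOfEq K hker).trans (Ideal.quotientKerAlgEquivOfSurjective hρ))⟩

end Kernel

/-! ### Symmetric forms and isotropic subspaces -/

section Bilinear

variable {K E : Type*} [Field K] [AddCommGroup E] [Module K E]

theorem span_range_coe_basis {ι : Type*} {V : Submodule K E} (b : Module.Basis ι K V) :
    Submodule.span K (Set.range fun i => (b i : E)) = V := by
  have h : (Set.range fun i => (b i : E)) = V.subtype '' Set.range b := by
    rw [← Set.range_comp]; rfl
  rw [h, Submodule.span_image, b.span_eq, Submodule.map_top, Submodule.range_subtype]

variable [Module.Finite K E]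

theorem exists_basis_form_eq_two [IsAlgClosed K] [CharZero K] {B : LinearMap.BilinForm K E}
    (hB : B.IsSymm) {V : Submodule K E} (hV : Disjoint V (B.orthogonal V)) {d : ℕ}
    (hd : Module.finrank K V = d) :
    ∃ b : Module.Basis (Fin d) K V, ∀ i j, B (b i) (b j) = if i = j then 2 else 0 := by
  subst hd
  have : Invertible (2 : K) := invertibleOfNonzero two_ne_zero
  have hr : (B.restrict V).Nondegenerate :=
    B.nondegenerate_restrict_of_disjoint_orthogonal hB.isRefl hV
  have hs : LinearMap.IsSymm (B.restrict V) := ⟨fun x y => hB.eq x y⟩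
  obtain ⟨b, hb⟩ := LinearMap.BilinForm.exists_orthogonal_basis hs
  have hne := LinearMap.IsOrthoᵢ.not_isOrtho_basis_self_of_separatingLeft hb hr.1
  -- Square roots rescale each vector to norm 2, the value of ∂²(y²).
  choose t ht using fun i => IsAlgClosed.exists_pow_nat_eq (2 / (B.restrict V) (b i) (b i)) two_pos
  have ht0 : ∀ i, t i ≠ 0 := fun i h0 => by
    have h := ht i
    rw [h0, zero_pow two_ne_zero, eq_comm, div_eq_zero_iff] at h
    exact h.elim two_ne_zero (hne i)
  refine ⟨b.unitsSMul fun i => Units.mk0 (t i) (ht0 i), fun i j => ?_⟩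
  rw [Module.Basis.unitsSMul_apply, Module.Basis.unitsSMul_apply]
  change B (t i • (b i : E)) (t j • (b j : E)) = _
  rw [map_smul, map_smul, LinearMap.smul_apply, smul_eq_mul, smul_eq_mul, ← mul_assoc]
  split_ifs with hij
  · subst hij
    rw [← pow_two, ht]
    exact div_mul_cancel₀ _ (hne i)
  · have h : B (b i) (b j) = 0 := hb hij
    rw [h, mul_zero]

theorem finrank_inf_of_isCompl {N N' Z : Submodule K E} (h : IsCompl N N') (hN : N ≤ Z) {k : ℕ}
    (hZ : Module.finrank K Z = k + Module.finrank K N) :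
    N ⊔ N' ⊓ Z = Z ∧ Module.finrank K ↥(N' ⊓ Z) = k := by
  have hsup : N ⊔ N' ⊓ Z = Z := by rw [← sup_inf_assoc_of_le _ hN, h.sup_eq_top, top_inf_eq]
  have hinf : N ⊓ (N' ⊓ Z) = ⊥ := by rw [← inf_assoc, h.inf_eq_bot, bot_inf_eq]
  have h2 := Submodule.finrank_sup_add_finrank_inf_eq N (N' ⊓ Z)
  rw [hsup, hinf, finrank_bot] at h2
  exact ⟨hsup, by omega⟩

/-- A space with a nondegenerate symmetric form and an isotropic subspace `N` such that
`N ≤ N^⊥ ≤ M`: an orthogonal system spanning `N^⊥` over `N`, and an isotropic system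
orthogonal to it spanning `M` over `N^⊥`. -/
theorem exists_adapted_system [IsAlgClosed K] [CharZero K] {B : LinearMap.BilinForm K E}
    (hB : B.IsSymm) (hnd : B.Nondegenerate) {N M : Submodule K E} (hN : N ≤ B.orthogonal N)
    (hM : B.orthogonal N ≤ M) {n d : ℕ}
    (hd : Module.finrank K (B.orthogonal N) = d + Module.finrank K N)
    (hn : Module.finrank K M = n + Module.finrank K (B.orthogonal N)) :
    ∃ (u : Fin n → E) (v : Fin d → E), (∀ j, v j ∈ B.orthogonal N) ∧
      (∀ i j, B (v i) (v j) = if i = j then 2 else 0) ∧ (∀ i j, B (u i) (v j) = 0) ∧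
      (∀ i j, B (u i) (u j) = 0) ∧
      Submodule.span K (Set.range u) ⊔ Submodule.span K (Set.range v) ⊔ N = M ∧
      ∀ c : Fin n → K, ∑ i, c i • u i ∈ B.orthogonal N → c = 0 := by
  have hCC : B.orthogonal (B.orthogonal N) = N :=
    LinearMap.BilinForm.orthogonal_orthogonal hnd hB.isRefl N
  obtain ⟨N', hN'⟩ := Submodule.exists_isCompl N
  obtain ⟨hV, hVd⟩ := finrank_inf_of_isCompl hN' hN hd
  set V := N' ⊓ B.orthogonal N with hVdef
  have hVC : V ≤ B.orthogonal N := inf_le_right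
  -- Since N + V = N^⊥, such an x lies in N^⊥⊥ = N. Hence B is nondegenerate on V, and E splits as V
  -- ⊕ V^⊥.
  have perp : ∀ x, x ∈ B.orthogonal N → x ∈ B.orthogonal V → x ∈ N := by
    intro x hxN hxV
    rw [← hCC, LinearMap.BilinForm.mem_orthogonal_iff]
    intro y hy
    rw [← hV] at hy
    obtain ⟨a, ha, b, hb, rfl⟩ := Submodule.mem_sup.mp hy
    rw [map_add, LinearMap.add_apply, hxN a ha, hxV b hb, add_zero]
  have disj : ∀ x ∈ N', x ∈ N → x = 0 := fun x h h' => by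
    have : x ∈ N ⊓ N' := ⟨h', h⟩
    rwa [hN'.inf_eq_bot, Submodule.mem_bot] at this
  have hVdisj : Disjoint V (B.orthogonal V) := by
    rw [Submodule.disjoint_def]
    exact fun x hx hx' => disj x hx.1 (perp x hx.2 hx')
  have hVcompl := (LinearMap.BilinForm.isCompl_orthogonal_iff_disjoint hB.isRefl).mpr hVdisj
  have hNZ : N ≤ B.orthogonal V ⊓ M := by
    refine le_inf ?_ (hN.trans hM)
    conv_lhs => rw [← hCC]
    exact LinearMap.BilinForm.orthogonal_le hVC
  have hZ : Module.finrank K ↥(B.orthogonal V ⊓ M) = n + Module.finrank K N := by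
    have h := (finrank_inf_of_isCompl hVcompl (hVC.trans hM) (k := n + Module.finrank K N)
      (by omega)).2
    exact h
  have hVZ : V ⊔ B.orthogonal V ⊓ M = M := by
    rw [← sup_inf_assoc_of_le _ (hVC.trans hM), hVcompl.sup_eq_top, top_inf_eq]
  obtain ⟨hW, hWn⟩ := finrank_inf_of_isCompl hN' hNZ hZ
  set W := N' ⊓ (B.orthogonal V ⊓ M) with hWdef
  obtain ⟨b, hb⟩ := exists_basis_form_eq_two hB hVdisj hVd
  let w := Module.finBasisOfFinrankEq K W hWn
  have hwC : ∀ c : Fin n → K, ∑ i, c i • (w i : E) ∈ B.orthogonal N → c = 0 := by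
    intro c hc
    have hx : ((∑ i, c i • w i : W) : E) = ∑ i, c i • (w i : E) := by simp
    rw [← hx] at hc
    have h0 := disj _ (∑ i, c i • w i : W).2.1 (perp _ hc (∑ i, c i • w i : W).2.2.1)
    have h1 : ∑ i, c i • w i = 0 := Subtype.ext h0
    funext i
    exact Fintype.linearIndependent_iff.mp w.linearIndependent c h1 i
  -- The w_i are independent modulo N^⊥, so they pair faithfully with N; therefore elements of N
  -- realise arbitrary values against the w_i.
  let L : (Fin n → K) →ₗ[K] N →ₗ[K] K :=
    (LinearMap.lcomp K K N.subtype) ∘ₗ B ∘ₗ (Fintype.linearCombination K fun i => (w i : E))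
  have hL : ∀ c y, L c y = B (∑ i, c i • (w i : E)) y := fun c y => by
    simp [L, Fintype.linearCombination_apply]
  have hLinj : Function.Injective L := by
    rw [injective_iff_map_eq_zero]
    intro c hc
    refine hwC c fun y hy => ?_
    rw [hB.isRefl.eq_iff, ← hL c ⟨y, hy⟩, hc, LinearMap.zero_apply]
  have hLsurj := LinearMap.flip_surjective_iff₁.mpr hLinj
  -- In B(w_i + y_i, w_j + y_j) the two cross terms each contribute -B(w_i, w_j)/2, and B(y_i, y_j)
  -- = 0 because N is isotropic.
  have hy : ∀ j, ∃ y : N, ∀ i, B (w i) y = -(B (w i) (w j) / 2) := fun j => by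
    obtain ⟨y, hy⟩ := hLsurj (Fintype.linearCombination K fun i => -(B (w i) (w j) / 2))
    refine ⟨y, fun i => ?_⟩
    have h := LinearMap.congr_fun hy (Pi.single i 1)
    rw [LinearMap.flip_apply, hL, Fintype.linearCombination_apply_single] at h
    simpa [Pi.single_apply, ite_smul] using h
  choose y hy using hy
  have hyN : ∀ c : Fin n → K, ∑ i, c i • (y i : E) ∈ N := fun c =>
    Submodule.sum_mem _ fun i _ => Submodule.smul_mem _ _ (y i).2
  refine ⟨fun i => w i + y i, fun j => b j, fun j => hVC (b j).2, hb, fun i j => ?_, fun i j => ?_,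
    ?_, fun c hc => hwC c ?_⟩
  · rw [map_add, LinearMap.add_apply, hVC (b j).2 _ (y i).2, hB.eq, (w i).2.2.1 _ (b j).2, add_zero]
  · simp only [map_add, LinearMap.add_apply]
    rw [hN (y j).2 _ (y i).2, hB.eq (y i), hy, hy, hB.eq (w j) (w i)]
    ring
  · have hWspan := span_range_coe_basis w
    have hVspan := span_range_coe_basis b
    rw [hVspan]
    apply le_antisymm
    · refine sup_le (sup_le (Submodule.span_le.mpr ?_) (hVC.trans hM)) (hN.trans hM)
      rintro _ ⟨i, rfl⟩
      exact Submodule.add_mem _ (w i).2.2.2 ((hN.trans hM) (y i).2)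
    · conv_lhs => rw [← hVZ, ← hW]
      refine sup_le (le_sup_of_le_left le_sup_right) (sup_le le_sup_right
        (hWspan.ge.trans (Submodule.span_le.mpr ?_)))
      rintro _ ⟨i, rfl⟩
      have h : (w i : E) = (w i + y i) + -(y i : E) := by abel
      change (w i : E) ∈ _
      rw [h]
      exact Submodule.add_mem _
        (Submodule.mem_sup_left (Submodule.mem_sup_left (Submodule.subset_span ⟨i, rfl⟩)))
        (Submodule.mem_sup_right (Submodule.neg_mem _ (y i).2))
  · have h : ∑ i, c i • (w i : E) = ∑ i, c i • ((w i : E) + y i) - ∑ i, c i • (y i : E) := by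
      simp [smul_add, Finset.sum_add_distrib]
    rw [h]
    exact Submodule.sub_mem _ hc (hN (hyN c))

end Bilinear

/-! ### Artinian local algebras with residue field K -/

section Artinian

variable {K : Type*} [Field K] {A : Type*} [CommRing A] [Algebra K A] [IsLocalRing A]

theorem mem_maxPow {i : ℕ} {x : A} : x ∈ maxPow K A i ↔ x ∈ IsLocalRing.maximalIdeal A ^ i :=
  Iff.rfl

theorem exists_algebraMap_sub_mem
    (hA : ∃ (r : ℕ) (f : MvPowerSeries (Fin r) K →ₐ[K] A), Function.Surjective f) (a : A) :
    ∃ c : K, a - algebraMap K A c ∈ IsLocalRing.maximalIdeal A := by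
  obtain ⟨r, π, hπ⟩ := hA
  obtain ⟨f, rfl⟩ := hπ a
  refine ⟨MvPowerSeries.constantCoeff f, ?_⟩
  have h := maximalIdeal_pow_eq_map hπ 1
  rw [pow_one, pow_one] at h
  rw [h, ← π.commutes, ← map_sub]
  refine Ideal.mem_map_of_mem π ((mem_maximalIdeal_iff _).mpr ?_)
  rw [map_sub, sub_eq_zero]
  exact (MvPowerSeries.constantCoeff_C _).symm

/-- Modulo 𝔪^(i+1), scalars from A act on 𝔪^i through K, so ideal generators of 𝔪^i span it over K
up to 𝔪^(i+1). -/
theorem fg_maxPow_of_succ [IsNoetherianRing A]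
    (hres : ∀ a : A, ∃ c : K, a - algebraMap K A c ∈ IsLocalRing.maximalIdeal A) {i : ℕ}
    (h : (maxPow K A (i + 1)).FG) : (maxPow K A i).FG := by
  obtain ⟨s, hs⟩ := IsNoetherian.noetherian (IsLocalRing.maximalIdeal A ^ i)
  have hle : Submodule.span K (s : Set A) ≤ maxPow K A i := by
    rw [Submodule.span_le]
    intro x hx
    rw [SetLike.mem_coe, mem_maxPow, ← hs]
    exact Submodule.subset_span hx
  have heq : maxPow K A i = Submodule.span K (s : Set A) ⊔ maxPow K A (i + 1) := by
    apply le_antisymm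
    · intro x hx
      rw [mem_maxPow, ← hs] at hx
      induction hx using Submodule.span_induction with
      | mem x hx => exact Submodule.mem_sup_left (Submodule.subset_span hx)
      | zero => exact Submodule.zero_mem _
      | add x y _ _ hx hy => exact Submodule.add_mem _ hx hy
      | smul a x hxs hx =>
        obtain ⟨c, hc⟩ := hres a
        have h2 : a • x = c • x + (a - algebraMap K A c) * x := by
          rw [smul_eq_mul, Algebra.smul_def c x]; ring
        rw [h2]
        refine Submodule.add_mem _ (Submodule.smul_mem _ _ hx) (Submodule.mem_sup_right ?_)
        rw [mem_maxPow, pow_succ']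
        exact Ideal.mul_mem_mul hc (hs ▸ hxs)
    · exact sup_le hle (Ideal.pow_le_pow_right (Nat.le_succ i))
  rw [heq]
  exact (Submodule.fg_span s.finite_toSet).sup h

theorem finite_of_isArtinianRing [IsArtinianRing A]
    (hres : ∀ a : A, ∃ c : K, a - algebraMap K A c ∈ IsLocalRing.maximalIdeal A) :
    Module.Finite K A := by
  obtain ⟨N, hN⟩ := IsArtinianRing.isNilpotent_jacobson_bot (R := A)
  rw [IsLocalRing.jacobson_eq_maximalIdeal _ bot_ne_top] at hN
  have key : ∀ j ≤ N, (maxPow K A (N - j)).FG := by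
    intro j
    induction j with
    | zero =>
      intro _
      have : maxPow K A (N - 0) = ⊥ := by
        rw [eq_bot_iff]
        intro x hx
        rw [mem_maxPow, Nat.sub_zero, hN] at hx
        exact hx
      rw [this]
      exact Submodule.fg_bot
    | succ j ih =>
      intro hj
      apply fg_maxPow_of_succ hres
      rw [show N - (j + 1) + 1 = N - j by omega]
      exact ih (by omega)
  have h := key N le_rfl
  rw [Module.finite_def]
  have htop : maxPow K A (N - N) = ⊤ := by
    rw [eq_top_iff]
    intro x _
    simp
  rwa [htop] at h

/-- Equal dimensions force 𝔪^(i+1) = 𝔪^i, and Nakayama applies. -/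
theorem maximalIdeal_pow_eq_bot_of_finrank_eq [Module.Finite K A] {i : ℕ}
    (h : Module.finrank K (maxPow K A (i + 1)) = Module.finrank K (maxPow K A i)) :
    IsLocalRing.maximalIdeal A ^ i = ⊥ := by
  have : IsNoetherianRing A := IsNoetherianRing.of_finite K A
  have hle : maxPow K A (i + 1) ≤ maxPow K A i := Ideal.pow_le_pow_right (Nat.le_succ i)
  have heq := Submodule.eq_of_le_of_finrank_eq hle h
  refine Submodule.eq_bot_of_le_smul_of_le_jacobson_bot (IsLocalRing.maximalIdeal A) _
    (IsNoetherian.noetherian _) ?_ (IsLocalRing.maximalIdeal_le_jacobson _)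
  rw [smul_eq_mul, ← pow_succ']
  intro x hx
  rw [← mem_maxPow (K := K), ← heq] at hx
  exact hx

/-- Descend through the powers of 𝔪: if x kills 𝔪^(i+1), then x𝔪^i lies in the socle and in the
kernel of φ, hence is zero. At i = 0 this gives x = 0. -/
theorem eq_zero_of_forall_apply_mul_eq_zero {k : ℕ} (hk : IsLocalRing.maximalIdeal A ^ k = ⊥)
    {φ : A →ₗ[K] K}
    (hφ : ∀ x ∈ (⊥ : Ideal A).colon (IsLocalRing.maximalIdeal A : Set A), φ x = 0 → x = 0)
    (x : A) (hx : ∀ y, φ (x * y) = 0) : x = 0 := by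
  have key : ∀ j, ∀ z ∈ IsLocalRing.maximalIdeal A ^ (k - j), x * z = 0 := by
    intro j
    induction j with
    | zero =>
      intro z hz
      rw [Nat.sub_zero, hk, Submodule.mem_bot] at hz
      rw [hz, mul_zero]
    | succ j ih =>
      intro z hz
      refine hφ _ ?_ (hx z)
      rw [Submodule.mem_colon]
      intro s hs
      rw [Submodule.mem_bot, smul_eq_mul, mul_assoc]
      refine ih _ ?_
      have h1 : z * s ∈ IsLocalRing.maximalIdeal A ^ (k - (j + 1) + 1) := by
        rw [pow_succ]
        exact Ideal.mul_mem_mul hz hs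
      exact Ideal.pow_le_pow_right (by omega) h1
  have := key k 1 (by simp)
  rwa [mul_one] at this

theorem exists_linearMap_ne_zero_on_socle
    (hs : Module.finrank K
      ↥((⊥ : Ideal A).colon (IsLocalRing.maximalIdeal A : Set A)) = 1) :
    ∃ φ : A →ₗ[K] K,
      ∀ x ∈ (⊥ : Ideal A).colon (IsLocalRing.maximalIdeal A : Set A), φ x = 0 → x = 0 := by
  obtain ⟨s, hs0, hs⟩ := finrank_eq_one_iff'.mp hs
  obtain ⟨φ, hφ⟩ := Module.Projective.exists_dual_eq_one K
    (show (s : A) ≠ 0 from fun h => hs0 (Subtype.ext h))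
  refine ⟨φ, fun x hx hx0 => ?_⟩
  obtain ⟨c, hc⟩ := hs ⟨x, hx⟩
  have hc' : c • (s : A) = x := congrArg Subtype.val hc
  rw [← hc', map_smul, hφ, smul_eq_mul, mul_one] at hx0
  rw [← hc', hx0, zero_smul]

/-- Generators of 𝔪 modulo 𝔪² let every element of 𝔪^i be approximated by polynomials in them modulo
𝔪^(i+1); nilpotency ends the process. -/
theorem aeval_surjective_of_le_span_sup {k m : ℕ} (hk : IsLocalRing.maximalIdeal A ^ k = ⊥)
    (hres : ∀ a : A, ∃ c : K, a - algebraMap K A c ∈ IsLocalRing.maximalIdeal A)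
    {a : Fin m → A}
    (ha : maxPow K A 1 ≤ Submodule.span K (Set.range a) ⊔ maxPow K A 2) :
    Function.Surjective (MvPolynomial.aeval a : MvPolynomial (Fin m) K →ₐ[K] A) := by
  set S := (MvPolynomial.aeval a : MvPolynomial (Fin m) K →ₐ[K] A).range with hS
  have haS : Submodule.span K (Set.range a) ≤ Subalgebra.toSubmodule S := by
    rw [Submodule.span_le]
    rintro _ ⟨i, rfl⟩
    exact ⟨MvPolynomial.X i, MvPolynomial.aeval_X _ _⟩
  have step : ∀ i, ∀ x ∈ IsLocalRing.maximalIdeal A ^ i,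
      ∃ s ∈ S, x - s ∈ IsLocalRing.maximalIdeal A ^ (i + 1) := by
    intro i
    induction i with
    | zero =>
      intro x _
      obtain ⟨c, hc⟩ := hres x
      exact ⟨_, S.algebraMap_mem c, by rwa [zero_add, pow_one]⟩
    | succ i ih =>
      intro x hx
      rw [pow_succ] at hx
      refine Submodule.mul_induction_on hx (fun x hx y hy => ?_) ?_
      · obtain ⟨s, hs, hxs⟩ := ih x hx
        rw [← pow_one (IsLocalRing.maximalIdeal A), ← mem_maxPow (K := K)] at hy
        obtain ⟨t, ht, y', hy', rfl⟩ := Submodule.mem_sup.mp (ha hy)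
        refine ⟨s * t, S.mul_mem hs (haS ht), ?_⟩
        have h1 : x * (t + y') - s * t = (x - s) * (t + y') + s * y' := by ring
        have hs' : s ∈ IsLocalRing.maximalIdeal A ^ i := by
          have h := Ideal.sub_mem _ hx (Ideal.pow_le_pow_right (Nat.le_succ i) hxs)
          rwa [sub_sub_cancel] at h
        rw [h1]
        refine Ideal.add_mem _ ?_ ?_
        · rw [pow_succ]
          exact Ideal.mul_mem_mul hxs (by simpa using (mem_maxPow (K := K)).mp hy)
        · have h := Ideal.mul_mem_mul hs' ((mem_maxPow (K := K)).mp hy')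
          rwa [← pow_add] at h
      · rintro x y ⟨s, hs, hx⟩ ⟨t, ht, hy⟩
        refine ⟨s + t, S.add_mem hs ht, ?_⟩
        have h : x + y - (s + t) = (x - s) + (y - t) := by ring
        rw [h]
        exact Ideal.add_mem _ hx hy
  have key : ∀ j, ∀ x ∈ IsLocalRing.maximalIdeal A ^ (k - j), x ∈ S := by
    intro j
    induction j with
    | zero =>
      intro x hx
      rw [Nat.sub_zero, hk, Submodule.mem_bot] at hx
      rw [hx]
      exact S.zero_mem
    | succ j ih =>
      intro x hx
      obtain ⟨s, hs, h⟩ := step _ x hx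
      have h2 := S.add_mem (ih _ (Ideal.pow_le_pow_right (by omega) h)) hs
      rwa [sub_add_cancel] at h2
  exact fun x => key k x (by simp)

end Artinian

/-! ### The cubic form with given third moments -/

section Moments

variable {K : Type*} [Field K] {n d : ℕ}

theorem coeff_sum_sq_mapDomain (β : Fin n →₀ ℕ) :
    (∑ j : Fin d, (MvPolynomial.X (Fin.natAdd n j) : MvPolynomial (Fin (n + d)) K) ^ 2).coeff
      (β.mapDomain (Fin.castAdd d)) = 0 := by
  classical
  rw [MvPolynomial.coeff_sum]
  refine Finset.sum_eq_zero fun j _ => ?_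
  rw [MvPolynomial.coeff_X_pow, if_neg]
  intro h
  have h2 := DFunLike.congr_fun h (Fin.natAdd n j)
  rw [Finsupp.single_eq_same, Finsupp.mapDomain_of_notMem_range] at h2
  · omega
  · rintro ⟨i, hi⟩
    have := congrArg Fin.val hi
    simp at this
    omega

theorem prod_pow_single {A ι : Type*} [CommRing A] [Fintype ι] [DecidableEq ι] (a : ι → A) (i : ι) :
    ∏ j, a j ^ (Finsupp.single i 1 : ι →₀ ℕ) j = a i := by
  rw [Finset.prod_eq_single i]
  · simp
  · intro j _ hj
    rw [Finsupp.single_eq_of_ne hj, pow_zero]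
  · simp

theorem prod_pow_add_single {A ι : Type*} [CommRing A] [Fintype ι] [DecidableEq ι] (a : ι → A) (α : ι →₀ ℕ)
    (i : ι) : ∏ j, a j ^ (α + Finsupp.single i 1 : ι →₀ ℕ) j = (∏ j, a j ^ α j) * a i := by
  conv_rhs => rw [← prod_pow_single a i]
  rw [← Finset.prod_mul_distrib]
  exact Finset.prod_congr rfl fun j _ => by rw [Finsupp.add_apply, pow_add]

/-- The cubic form with prescribed third moments. -/
def cubicForm (T : (Fin n →₀ ℕ) → K) : MvPolynomial (Fin n) K :=
  ∑ α ∈ (Finset.univ : Finset (Fin n)).finsuppAntidiag 3,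
    MvPolynomial.monomial α (T α / ∏ i, ((α i).factorial : K))

theorem mem_finsuppAntidiag_univ {α : Fin n →₀ ℕ} {k : ℕ} :
    α ∈ (Finset.univ : Finset (Fin n)).finsuppAntidiag k ↔ α.degree = k := by
  rw [Finset.mem_finsuppAntidiag, Finsupp.degree_eq_sum]
  simp

theorem isHomogeneous_cubicForm (T : (Fin n →₀ ℕ) → K) : (cubicForm T).IsHomogeneous 3 :=
  MvPolynomial.IsHomogeneous.sum _ _ _ fun _ hα =>
    MvPolynomial.isHomogeneous_monomial _ (mem_finsuppAntidiag_univ.mp hα)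

theorem coeff_zero_iterPartial_cubicForm [CharZero K] (T : (Fin n →₀ ℕ) → K) {α : Fin n →₀ ℕ}
    (hα : α.degree = 3) : (iterPartial α (cubicForm T)).coeff 0 = T α := by
  classical
  rw [coeff_zero_iterPartial, cubicForm, MvPolynomial.coeff_sum, Finset.sum_eq_single α,
    MvPolynomial.coeff_monomial, if_pos rfl, div_mul_cancel₀]
  · exact Finset.prod_ne_zero_iff.mpr fun i _ => by exact_mod_cast Nat.factorial_ne_zero _
  · intro β _ hβ
    rw [MvPolynomial.coeff_monomial, if_neg hβ]
  · intro h
    exact absurd (mem_finsuppAntidiag_univ.mpr hα) h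

end Moments

/-! ### Normal form of a Gorenstein algebra -/

section Structure

variable {K : Type*} [Field K] {A : Type*} [CommRing A] [Algebra K A] [IsLocalRing A] {n d : ℕ}

/-- Generators `u`, `v` of the maximal ideal of `A` and a functional on `A` for which `A` is in
the normal form of a cubic in the `u`-variables plus the squares of the `v`-variables. -/
structure IsNormalForm (φ : A →ₗ[K] K) (u : Fin n → A) (v : Fin d → A) : Prop where
  pow_four : IsLocalRing.maximalIdeal A ^ 4 = ⊥
  nondeg : ∀ x, (∀ y, φ (x * y) = 0) → x = 0
  u_mem : ∀ i, u i ∈ IsLocalRing.maximalIdeal A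
  v_mem : ∀ j, v j ∈ IsLocalRing.maximalIdeal A
  v_mul : ∀ j, ∀ x ∈ IsLocalRing.maximalIdeal A ^ 2, v j * x = 0
  map_one : φ 1 = 0
  map_u : ∀ i, φ (u i) = 0
  map_v : ∀ j, φ (v j) = 0
  map_v_mul_v : ∀ i j, φ (v i * v j) = if i = j then 2 else 0
  map_u_mul_v : ∀ i j, φ (u i * v j) = 0
  map_u_mul_u : ∀ i j, φ (u i * u j) = 0
  le_span : maxPow K A 1 ≤
    Submodule.span K (Set.range u) ⊔ Submodule.span K (Set.range v) ⊔ maxPow K A 2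
  indep : ∀ c : Fin n → K, (∀ x ∈ IsLocalRing.maximalIdeal A ^ 2, (∑ i, c i • u i) * x = 0) → c = 0

namespace IsNormalForm

variable {φ : A →ₗ[K] K} {u : Fin n → A} {v : Fin d → A}

theorem prod_pow_mem {ι : Type*} [Fintype ι] {a : ι → A}
    (ha : ∀ i, a i ∈ IsLocalRing.maximalIdeal A) (α : ι →₀ ℕ) :
    ∏ i, a i ^ α i ∈ IsLocalRing.maximalIdeal A ^ α.degree := by
  rw [Finsupp.degree_eq_sum, ← Finset.prod_pow_eq_pow_sum]
  exact Ideal.prod_mem_prod fun i _ => Ideal.pow_mem_pow (ha i) _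

theorem append_mem (h : IsNormalForm φ u v) (i : Fin (n + d)) :
    Fin.append u v i ∈ IsLocalRing.maximalIdeal A := by
  refine Fin.addCases (fun i => ?_) (fun j => ?_) i
  · rw [Fin.append_left]; exact h.u_mem i
  · rw [Fin.append_right]; exact h.v_mem j

theorem map_prod_pow [CharZero K] (h : IsNormalForm φ u v) (α : Fin (n + d) →₀ ℕ) :
    φ (∏ i, Fin.append u v i ^ α i) =
      (iterPartial α (addSquares d (cubicForm fun β => φ (∏ i, u i ^ β i)))).coeff 0 := by
  classical
  set F₃ := cubicForm fun β => φ (∏ i, u i ^ β i) with hF₃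
  -- If some v_j occurs, ∂_j F = 2y_j leaves only v_j² on the polynomial side; on the algebra side
  -- v_j kills 𝔪², and φ vanishes on v_j and on its products with the other generators.
  by_cases hα : ∃ j : Fin d, α (Fin.natAdd n j) ≠ 0
  · obtain ⟨j, hj⟩ := hα
    obtain ⟨γ, rfl⟩ : ∃ γ, α = γ + Finsupp.single (Fin.natAdd n j) 1 :=
      ⟨α - Finsupp.single (Fin.natAdd n j) 1, (tsub_add_cancel_of_le (by
        rw [Finsupp.single_le_iff]; omega)).symm⟩
    rw [prod_pow_add_single, Fin.append_right, iterPartial_add, Module.End.mul_apply,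
      iterPartial_single_one, pderiv_natAdd_addSquares, coeff_zero_iterPartial,
      MvPolynomial.coeff_smul]
    rcases Nat.lt_trichotomy γ.degree 1 with h1 | h1 | h1
    · have : γ = 0 := (Finsupp.degree_eq_zero_iff γ).mp (by omega)
      subst this
      simp [h.map_v]
    · obtain ⟨k, rfl⟩ := exists_single_of_degree_eq_one h1
      rw [prod_pow_single, Finset.prod_eq_one, mul_one, MvPolynomial.coeff_X]
      · refine Fin.addCases (fun i => ?_) (fun k => ?_) k
        · rw [Fin.append_left, h.map_u_mul_v, if_neg, smul_zero]
          intro hk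
          have := congrArg Fin.val (Finsupp.single_left_injective one_ne_zero hk)
          simp at this
          omega
        · rw [Fin.append_right, h.map_v_mul_v]
          simp [Finsupp.single_left_inj, eq_comm]
      · intro i _
        rw [Finsupp.single_apply]
        split_ifs <;> simp
    · rw [(MvPolynomial.isHomogeneous_X K _).coeff_eq_zero (by omega), smul_zero, zero_mul,
        mul_comm, h.v_mul, map_zero]
      exact Ideal.pow_le_pow_right h1 (prod_pow_mem h.append_mem γ)
  · push Not at hα
    obtain ⟨β, rfl⟩ : ∃ β : Fin n →₀ ℕ, α = β.mapDomain (Fin.castAdd d) := by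
      refine ⟨Finsupp.equivFunOnFinite.symm fun i => α (Fin.castAdd d i), ?_⟩
      ext k
      refine Fin.addCases (fun i => ?_) (fun j => ?_) k
      · rw [Finsupp.mapDomain_apply (Fin.castAdd_injective n d)]
        rfl
      · rw [hα, Finsupp.mapDomain_of_notMem_range]
        rintro ⟨i, hi⟩
        have := congrArg Fin.val hi
        simp at this
        omega
    have hval : ∀ i, (β.mapDomain (Fin.castAdd d)) (Fin.castAdd d i) = β i := fun i =>
      Finsupp.mapDomain_apply (Fin.castAdd_injective n d) _ _
    have hprod : ∏ i, Fin.append u v i ^ (β.mapDomain (Fin.castAdd d)) i = ∏ i, u i ^ β i := by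
      rw [Fin.prod_univ_add]
      simp only [hα, pow_zero, Finset.prod_const_one, mul_one, hval, Fin.append_left]
    have hcoeff : (iterPartial (β.mapDomain (Fin.castAdd d)) (addSquares d F₃)).coeff 0
        = (iterPartial β F₃).coeff 0 := by
      rw [coeff_zero_iterPartial, coeff_zero_iterPartial, addSquares, MvPolynomial.coeff_add,
        coeff_sum_sq_mapDomain, add_zero,
        MvPolynomial.coeff_rename_mapDomain _ (Fin.castAdd_injective n d), Fin.prod_univ_add]
      simp only [hα, Nat.factorial_zero, Nat.cast_one, Finset.prod_const_one, mul_one, hval]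
    rw [hprod, hcoeff]
    -- For monomials in u alone, degree 3 holds by construction of the cubic. In every other degree
    -- both sides vanish, by 𝔪⁴ = 0 or by the normalisation of φ.
    by_cases h3 : β.degree = 3
    · exact (coeff_zero_iterPartial_cubicForm (fun β => φ (∏ i, u i ^ β i)) h3).symm
    rw [coeff_zero_iterPartial, (isHomogeneous_cubicForm _).coeff_eq_zero h3, zero_mul]
    by_cases h4 : 4 ≤ β.degree
    · have hm := Ideal.pow_le_pow_right h4 (prod_pow_mem h.u_mem β)
      rw [h.pow_four, Submodule.mem_bot] at hm
      rw [hm, map_zero]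
    by_cases h0 : β = 0
    · subst h0
      simp [h.map_one]
    obtain ⟨i, γ, rfl⟩ := exists_eq_add_single h0
    rw [map_add, Finsupp.degree_single] at h3 h4
    rw [prod_pow_add_single]
    by_cases h1 : γ.degree = 0
    · rw [(Finsupp.degree_eq_zero_iff γ).mp h1]
      simp [h.map_u]
    · obtain ⟨k, rfl⟩ := exists_single_of_degree_eq_one (α := γ) (by omega)
      rw [prod_pow_single, h.map_u_mul_u]

theorem aeval_surjective (h : IsNormalForm φ u v)
    (hres : ∀ a : A, ∃ c : K, a - algebraMap K A c ∈ IsLocalRing.maximalIdeal A) :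
    Function.Surjective
      (MvPolynomial.aeval (Fin.append u v) : MvPolynomial (Fin (n + d)) K →ₐ[K] A) := by
  refine aeval_surjective_of_le_span_sup h.pow_four hres (h.le_span.trans ?_)
  refine sup_le_sup_right (sup_le (Submodule.span_mono ?_) (Submodule.span_mono ?_)) _
  · rintro _ ⟨i, rfl⟩
    exact ⟨Fin.castAdd d i, Fin.append_left u v i⟩
  · rintro _ ⟨j, rfl⟩
    exact ⟨Fin.natAdd n j, Fin.append_right u v j⟩

/-- Modulo 𝔪² the ideal 𝔪 is spanned by u and v. With w and the other factor supplying an element of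
𝔪², both the v_j and 𝔪² contribute nothing, so each factor reduces in turn to the u_i. -/
theorem map_mul_mul_eq_zero (h : IsNormalForm φ u v) {w : A}
    (hw : w ∈ IsLocalRing.maximalIdeal A) (hu : ∀ i j, φ (w * u i * u j) = 0) {x y : A}
    (hx : x ∈ IsLocalRing.maximalIdeal A) (hy : y ∈ IsLocalRing.maximalIdeal A) :
    φ (w * x * y) = 0 := by
  have mem2 : ∀ {a b : A}, a ∈ IsLocalRing.maximalIdeal A → b ∈ IsLocalRing.maximalIdeal A →
      a * b ∈ IsLocalRing.maximalIdeal A ^ 2 := fun ha hb => by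
    rw [pow_two]; exact Ideal.mul_mem_mul ha hb
  have zero4 : ∀ {a b : A}, a ∈ IsLocalRing.maximalIdeal A ^ 2 →
      b ∈ IsLocalRing.maximalIdeal A ^ 2 → a * b = 0 := fun ha hb => by
    have := Ideal.mul_mem_mul ha hb
    rwa [← pow_add, h.pow_four, Submodule.mem_bot] at this
  have main : ∀ y ∈ IsLocalRing.maximalIdeal A, (∀ i, φ (w * u i * y) = 0) →
      ∀ x ∈ IsLocalRing.maximalIdeal A, φ (w * x * y) = 0 := by
    intro y hy hyu x hx
    have hle : maxPow K A 1 ≤ LinearMap.ker (φ ∘ₗ LinearMap.mulLeft K (w * y)) := by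
      refine h.le_span.trans (sup_le (sup_le (Submodule.span_le.mpr ?_)
        (Submodule.span_le.mpr ?_)) ?_)
      · rintro _ ⟨i, rfl⟩
        change φ (w * y * u i) = 0
        rw [mul_right_comm, hyu]
      · rintro _ ⟨j, rfl⟩
        change φ (w * y * v j) = 0
        rw [mul_comm, h.v_mul j _ (mem2 hw hy), map_zero]
      · intro z hz
        change φ (w * y * z) = 0
        rw [zero4 (mem2 hw hy) hz, map_zero]
    have hx1 : x ∈ maxPow K A 1 := by rwa [mem_maxPow, pow_one]
    have := hle hx1
    change φ (w * y * x) = 0 at this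
    rwa [mul_right_comm]
  refine main y hy (fun i => ?_) x hx
  rw [mul_right_comm]
  exact main (u i) (h.u_mem i) (fun j => hu j i) y hy

theorem linearIndependent_pderiv [CharZero K] (h : IsNormalForm φ u v) :
    LinearIndependent K fun i =>
      MvPolynomial.pderiv i (cubicForm fun β => φ (∏ i, u i ^ β i)) := by
  classical
  rw [Fintype.linearIndependent_iff]
  intro c hc
  have hw : ∑ i, c i • u i ∈ IsLocalRing.maximalIdeal A :=
    Submodule.sum_mem _ fun i _ => Submodule.smul_of_tower_mem _ _ (h.u_mem i)
  -- Apply ∂_j ∂_k to the relation among partials: the constants so obtained are the third moments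
  -- of φ.
  have hu : ∀ j k, φ ((∑ i, c i • u i) * u j * u k) = 0 := by
    intro j k
    have h1 := congrArg (fun p => (iterPartial (Finsupp.single j 1 + Finsupp.single k 1) p).coeff 0)
      hc
    simp only [map_sum, map_smul, map_zero, MvPolynomial.coeff_zero, MvPolynomial.coeff_sum,
      MvPolynomial.coeff_smul, smul_eq_mul] at h1
    rw [Finset.sum_mul, Finset.sum_mul, map_sum, ← h1]
    refine Finset.sum_congr rfl fun i _ => ?_
    rw [← iterPartial_single_one, ← Module.End.mul_apply, ← iterPartial_add,
      coeff_zero_iterPartial_cubicForm _ (by simp), prod_pow_add_single, prod_pow_add_single,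
      prod_pow_single, smul_mul_assoc, smul_mul_assoc, map_smul, smul_eq_mul]
    congr 2
    ring
  refine fun i => congrFun (h.indep c fun x hx => h.nondeg _ fun y => ?_) i
  have hxy : x * y ∈ IsLocalRing.maximalIdeal A ^ 2 := Ideal.mul_mem_right _ _ hx
  rw [pow_two] at hxy
  rw [mul_assoc]
  refine Submodule.mul_induction_on hxy (fun a ha b hb => ?_) (fun a b ha hb => ?_)
  · rw [← mul_assoc]
    exact h.map_mul_mul_eq_zero hw hu ha hb
  · rw [mul_add, map_add, ha, hb, add_zero]

end IsNormalForm

theorem exists_isNormalForm [IsAlgClosed K] [CharZero K] [Module.Finite K A]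
    (h4 : IsLocalRing.maximalIdeal A ^ 4 = ⊥)
    (hs : Module.finrank K
      ↥((⊥ : Ideal A).colon (IsLocalRing.maximalIdeal A : Set A)) = 1)
    (r3 : Module.finrank K (maxPow K A 3) = 1) (r2 : Module.finrank K (maxPow K A 2) = n + 1)
    (r1 : Module.finrank K (maxPow K A 1) = n + d + (n + 1))
    (r0 : Module.finrank K (maxPow K A 0) = 1 + (n + d + (n + 1))) :
    ∃ (φ : A →ₗ[K] K) (u : Fin n → A) (v : Fin d → A), IsNormalForm φ u v := by
  have mem2 : ∀ {a b : A}, a ∈ IsLocalRing.maximalIdeal A → b ∈ IsLocalRing.maximalIdeal A →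
      a * b ∈ maxPow K A 2 := fun ha hb => by
    rw [mem_maxPow, pow_two]; exact Ideal.mul_mem_mul ha hb
  have zero4 : ∀ {a b : A}, a ∈ maxPow K A 2 → b ∈ maxPow K A 2 → a * b = 0 := fun ha hb => by
    have := Ideal.mul_mem_mul ha hb
    rwa [← pow_add, h4, Submodule.mem_bot] at this
  have h21 : maxPow K A 2 ≤ maxPow K A 1 := Ideal.pow_le_pow_right (by norm_num)
  -- 𝔪³ lies in the socle and both are one-dimensional, so they coincide.
  have hsocle : ((⊥ : Ideal A).colon (IsLocalRing.maximalIdeal A : Set A)).restrictScalars K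
      ≤ maxPow K A 2 := by
    have hle : maxPow K A 3 ≤
        ((⊥ : Ideal A).colon (IsLocalRing.maximalIdeal A : Set A)).restrictScalars K := by
      intro x hx
      change x ∈ (⊥ : Ideal A).colon (IsLocalRing.maximalIdeal A : Set A)
      rw [Submodule.mem_colon]
      intro s hs
      rw [← h4, pow_succ]
      exact Ideal.mul_mem_mul hx hs
    rw [← Submodule.eq_of_le_of_finrank_eq hle (r3.trans hs.symm)]
    exact Ideal.pow_le_pow_right (by norm_num)
  obtain ⟨φ₀, hφ₀⟩ := exists_linearMap_ne_zero_on_socle hs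
  have hnd₀ := eq_zero_of_forall_apply_mul_eq_zero h4 hφ₀
  let B : LinearMap.BilinForm K A := (LinearMap.mul K A).compr₂ φ₀
  have hBapp : ∀ x y, B x y = φ₀ (x * y) := fun x y => rfl
  have hB : B.IsSymm := ⟨fun x y => by rw [hBapp, hBapp, mul_comm]⟩
  have hBnd : B.Nondegenerate := by
    refine (LinearMap.IsRefl.nondegenerate_iff_separatingLeft hB.isRefl).mpr fun x hx => ?_
    exact hnd₀ x hx
  have hC : ∀ x, x ∈ B.orthogonal (maxPow K A 2) ↔
      ∀ y ∈ IsLocalRing.maximalIdeal A ^ 2, x * y = 0 := by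
    intro x
    constructor
    · intro hx y hy
      refine hnd₀ _ fun z => ?_
      have h := hx (y * z) (Ideal.mul_mem_right _ _ hy)
      change φ₀ (y * z * x) = 0 at h
      rwa [mul_assoc, mul_comm]
    · intro hx y hy
      change φ₀ (y * x) = 0
      rw [mul_comm, hx y hy, map_zero]
  have hm : ∀ {x : A}, x ∈ maxPow K A 1 ↔ x ∈ IsLocalRing.maximalIdeal A := by
    intro x; rw [mem_maxPow, pow_one]
  have hfin : Module.finrank K A = 1 + (n + d + (n + 1)) := by
    rw [← r0]
    have : maxPow K A 0 = ⊤ := by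
      rw [eq_top_iff]
      intro x _
      simp
    rw [this, finrank_top]
  have hCle : B.orthogonal (maxPow K A 2) ≤ maxPow K A 1 := by
    intro x hx
    rw [hm, IsLocalRing.mem_maximalIdeal, mem_nonunits_iff]
    intro hu
    have hbot : maxPow K A 2 = ⊥ := by
      rw [eq_bot_iff]
      intro y hy
      rw [Submodule.mem_bot]
      exact (hu.mul_right_eq_zero).mp ((hC x).mp hx y hy)
    rw [hbot, finrank_bot] at r2
    omega
  -- dim A = 2n + d + 2 and dim 𝔪² = n + 1, so dim (𝔪²)^⊥ = d + dim 𝔪², while 𝔪 exceeds (𝔪²)^⊥ by n.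
  have hCfin := LinearMap.BilinForm.finrank_orthogonal hBnd (maxPow K A 2)
  obtain ⟨u, v, hv, hvv, huv, huu, hspan, hindep⟩ := exists_adapted_system (n := n) (d := d) hB hBnd
    (N := maxPow K A 2) (M := maxPow K A 1)
    (fun x hx => (hC x).mpr fun y hy => zero4 hx hy) hCle (by omega) (by omega)
  have humem : ∀ i, u i ∈ IsLocalRing.maximalIdeal A := fun i => by
    refine hm.mp ?_
    rw [← hspan]
    exact Submodule.mem_sup_left (Submodule.mem_sup_left (Submodule.subset_span ⟨i, rfl⟩))
  have hvmem : ∀ j, v j ∈ IsLocalRing.maximalIdeal A := fun j => hm.mp (hCle (hv j))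
  -- 1, u and v together form a basis of a complement of 𝔪².
  let g : Option (Fin n ⊕ Fin d) → A := fun o => o.elim 1 (Sum.elim u v)
  have hg : ∀ c : Option (Fin n ⊕ Fin d) → K, ∑ i, c i • g i ∈ maxPow K A 2 → c = 0 := by
    intro c hc
    rw [Fintype.sum_option, Fintype.sum_sum_type] at hc
    simp only [g, Option.elim_none, Option.elim_some, Sum.elim_inl, Sum.elim_inr] at hc
    have hv' : ∑ j, c (some (Sum.inr j)) • v j ∈ B.orthogonal (maxPow K A 2) :=
      Submodule.sum_mem _ fun j _ => Submodule.smul_mem _ _ (hv j)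
    have hu' : ∑ i, c (some (Sum.inl i)) • u i ∈ IsLocalRing.maximalIdeal A :=
      Submodule.sum_mem _ fun i _ => Submodule.smul_of_tower_mem _ _ (humem i)
    have hc0 : c none = 0 := by
      by_contra hne
      have h1 : c none • (1 : A) ∈ maxPow K A 1 := by
        have h := Submodule.sub_mem _ (h21 hc) (Submodule.add_mem _ (hm.mpr hu') (hCle hv'))
        rwa [add_sub_cancel_right] at h
      have h2 := Submodule.smul_mem _ (c none)⁻¹ h1
      rw [smul_smul, inv_mul_cancel₀ hne, one_smul, hm] at h2
      exact (IsLocalRing.maximalIdeal.isMaximal A).ne_top ((Ideal.eq_top_iff_one _).mpr h2)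
    rw [hc0, zero_smul, zero_add] at hc
    have hNC : maxPow K A 2 ≤ B.orthogonal (maxPow K A 2) :=
      fun x hx => (hC x).mpr fun y hy => zero4 hx hy
    have hcu := hindep (fun i => c (some (Sum.inl i))) (by
      have h := Submodule.sub_mem _ (hNC hc) hv'
      rwa [add_sub_cancel_right] at h)
    have hcu' : ∀ i, c (some (Sum.inl i)) = 0 := fun i => congrFun hcu i
    simp only [hcu', zero_smul, Finset.sum_const_zero, zero_add] at hc
    funext o
    match o with
    | none => exact hc0
    | some (Sum.inl i) => exact hcu' i
    | some (Sum.inr j) =>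
      have h := (hv j) _ hc
      rw [map_sum, LinearMap.sum_apply] at h
      simpa [hvv] using h
  have hcompl : IsCompl (Submodule.span K (Set.range g)) (maxPow K A 2) := by
    have hdisj : Disjoint (Submodule.span K (Set.range g)) (maxPow K A 2) := by
      rw [Submodule.disjoint_def]
      intro x hx hx2
      obtain ⟨c, rfl⟩ := (Submodule.mem_span_range_iff_exists_fun K).mp hx
      simp [hg c hx2]
    refine ⟨hdisj, codisjoint_iff.mpr ?_⟩
    apply Submodule.eq_top_of_finrank_eq
    rw [finrank_span_sup g _ hg, r2, hfin]
    simp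
    omega
  -- Discarding φ₀ off 𝔪² removes the moments of degree below two. Nothing else is lost: the socle
  -- and all products of two generators lie in 𝔪².
  let φ : A →ₗ[K] K := LinearMap.ofIsCompl hcompl 0 (φ₀ ∘ₗ (maxPow K A 2).subtype)
  have hφg : ∀ i, φ (g i) = 0 := fun i => by
    have := LinearMap.ofIsCompl_apply_left hcompl (φ := 0) (ψ := φ₀ ∘ₗ (maxPow K A 2).subtype)
      ⟨g i, Submodule.subset_span ⟨i, rfl⟩⟩
    exact this
  have hφ2 : ∀ x ∈ maxPow K A 2, φ x = φ₀ x := fun x hx => by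
    have := LinearMap.ofIsCompl_apply_right hcompl (φ := 0) (ψ := φ₀ ∘ₗ (maxPow K A 2).subtype)
      ⟨x, hx⟩
    exact this
  refine ⟨φ, u, v, h4, ?_, humem, hvmem, fun j => (hC _).mp (hv j), hφg none,
    fun i => hφg (some (Sum.inl i)), fun j => hφg (some (Sum.inr j)), fun i j => ?_, fun i j => ?_,
    fun i j => ?_, hspan.ge, fun c hc => hindep c ((hC _).mpr hc)⟩
  · refine eq_zero_of_forall_apply_mul_eq_zero h4 fun x hx => ?_
    rw [hφ2 x (hsocle hx)]
    exact hφ₀ x hx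
  · exact (hφ2 _ (mem2 (hvmem i) (hvmem j))).trans (hvv i j)
  · exact (hφ2 _ (mem2 (humem i) (hvmem j))).trans (huv i j)
  · exact (hφ2 _ (mem2 (humem i) (humem j))).trans (huu i j)

theorem exists_algEquiv_addSquares [IsAlgClosed K] [CharZero K]
    (hA : ∃ (r : ℕ) (f : MvPowerSeries (Fin r) K →ₐ[K] A), Function.Surjective f)
    (hG : IsArtinianGorenstein K A)
    (hHF : ∀ i : ℕ, hilbertFunction K A i = ([1, n + d, n, 1] : List ℕ).getD i 0) :
    ∃ F₃ : MvPolynomial (Fin n) K, F₃.IsHomogeneous 3 ∧ IsNondegenerate F₃ ∧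
      Nonempty (A ≃ₐ[K] algebraOf (addSquares d F₃)) := by
  have hres := exists_algebraMap_sub_mem hA
  have := hG.1
  have hfin : Module.Finite K A := finite_of_isArtinianRing hres
  have hsum := hilbertFunction_add (K := K) (A := A)
  have h4 : IsLocalRing.maximalIdeal A ^ 4 = ⊥ := by
    apply maximalIdeal_pow_eq_bot_of_finrank_eq (K := K)
    have h := hsum 4
    rw [hHF] at h
    simpa using h
  have r4 : Module.finrank K (maxPow K A 4) = 0 := by
    have : maxPow K A 4 = ⊥ := by
      rw [eq_bot_iff]
      intro x hx
      rwa [mem_maxPow, h4] at hx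
    rw [this, finrank_bot]
  have e3 : 1 + Module.finrank K (maxPow K A 4) = Module.finrank K (maxPow K A 3) := by
    have := hsum 3; rwa [hHF] at this
  have e2 : n + Module.finrank K (maxPow K A 3) = Module.finrank K (maxPow K A 2) := by
    have := hsum 2; rwa [hHF] at this
  have e1 : n + d + Module.finrank K (maxPow K A 2) = Module.finrank K (maxPow K A 1) := by
    have := hsum 1; rwa [hHF] at this
  have e0 : 1 + Module.finrank K (maxPow K A 1) = Module.finrank K (maxPow K A 0) := by
    have := hsum 0; rwa [hHF] at this
  rw [r4] at e3
  rw [← e3] at e2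
  rw [← e2] at e1
  rw [← e1] at e0
  obtain ⟨φ, u, v, h⟩ := exists_isNormalForm h4 hG.2 e3.symm e2.symm e1.symm e0.symm
  have hli := h.linearIndependent_pderiv
  -- If n = 0 then 𝔪² and 𝔪³ have equal dimension, so 𝔪² = 0, contradicting dim 𝔪² = n + 1. With a
  -- variable present, independence of the partials shows that the cubic is nonzero.
  have hn : n ≠ 0 := by
    intro hn
    have h2 : IsLocalRing.maximalIdeal A ^ 2 = ⊥ :=
      maximalIdeal_pow_eq_bot_of_finrank_eq (K := K) (by rw [← e3, ← e2, hn])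
    have : maxPow K A 2 = ⊥ := by
      rw [eq_bot_iff]
      intro x hx
      rwa [mem_maxPow, h2] at hx
    rw [this, finrank_bot] at e2
    omega
  refine ⟨_, isHomogeneous_cubicForm _,
    isNondegenerate_of_linearIndependent (isHomogeneous_cubicForm _) (fun h0 => ?_) hli,
    nonempty_algEquiv_algebraOf h.map_prod_pow (h.aeval_surjective hres) h.nondeg⟩
  refine hli.ne_zero ⟨0, Nat.pos_of_ne_zero hn⟩ ?_
  rw [h0, map_zero]

end Structure

end InverseSystem

end

theorem theorem4p1 {K : Type*} [Field K] [IsAlgClosed K] [CharZero K]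
    (m n : ℕ) (hnm : n < m)
    (A : Type*) [CommRing A] [Algebra K A]
    -- `A` is a quotient of some power series ring `K[[x_1, …, x_r]]`
    (hA : ∃ (r : ℕ) (f : MvPowerSeries (Fin r) K →ₐ[K] A), Function.Surjective f) :
    (∃ _ : IsLocalRing A, InverseSystem.IsArtinianGorenstein K A ∧
        ∀ i : ℕ, InverseSystem.hilbertFunction K A i = ([1, m, n, 1] : List ℕ).getD i 0) ↔
      ∃ F₃ : MvPolynomial (Fin n) K, F₃.IsHomogeneous 3 ∧ InverseSystem.IsNondegenerate F₃ ∧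
        Nonempty (A ≃ₐ[K] InverseSystem.algebraOf
          (MvPolynomial.rename (Fin.castLE hnm.le) F₃ +
            ∑ j ∈ Finset.univ.filter (fun j : Fin m => n ≤ (j : ℕ)),
              (MvPolynomial.X j : MvPolynomial (Fin m) K) ^ 2)) := by
  obtain ⟨d, rfl⟩ := Nat.exists_eq_add_of_le hnm.le
  constructor
  · rintro ⟨_, hG, hHF⟩
    obtain ⟨F₃, hF, hnd, he⟩ := InverseSystem.exists_algEquiv_addSquares hA hG hHF
    exact ⟨F₃, hF, hnd, by rwa [InverseSystem.rename_castLE_add_sum_filter]⟩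
  · rintro ⟨F₃, hF, hnd, ⟨e⟩⟩
    rw [InverseSystem.rename_castLE_add_sum_filter] at e
    exact InverseSystem.gorenstein_of_algEquiv_addSquares hF hnd e
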